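/- Let $\mathfrak h$ be the real Lie algebra with basis $X_1,X_2,X_3$ and brackets $[X_1,X_2]=X_2$, $[X_1,X_3]=-X_3$, $[X_2,X_3]=0$, let $H$ be the connected and simply connected Lie group with Lie algebra $\mathfrak h$, and identify $\mathfrak h^*$ with $\mathbb R^3$ by the coordinates $x_i$ associated with $X_i$. Let $\Omega=\{x\in\mathfrak h^*: x_2^2+x_3^2\neq 0\}$, with the Lie–Poisson bivector $\Lambda_x(\xi,\eta)=\langle x,[\xi,\eta]\rangle$, and let $H_{x_1}=x_2\partial_2-x_3\partial_3$ be the derivation $\{x_1,\cdot\}$ on functions of $(x_2,x_3)$. Let $I(\Omega)$ be the algebra of smooth Casimir functions on $\Omega$. Let $H^k_\Lambda(\Omega)$ be the cohomology of the complex of smooth multivector fields on $\Omega$ with coboundary $\sigma=[\Lambda,\cdot\,]$ (Schouten bracket), and $H^k_{\Lambda,tan}(\Omega)$ the cohomology of its subcomplex of multivector fields tangent to the symplectic leaves; these are $I(\Omega)$-modules. Call such a module infinite dimensional if it is infinite dimensional as a real vector space and is finitely generated neither over the ring of $H$-invariant polynomial functions on $\mathfrak h^*$ nor over the ring of $H$-invariant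 real analytic functions on $\mathfrak h^*$ (both rings act through restriction to $\Omega$). Then the following hold. 1. $\Omega$ is the union of the $2$-dimensional coadjoint orbits of $H$ in $\mathfrak h^*$. 2. $H^0_{\Lambda,tan}(\Omega)\cong I(\Omega)$, the module $H^1_{\Lambda,tan}(\Omega)$ is infinite dimensional, and $H^k_{\Lambda,tan}(\Omega)=0$ for all $k>1$. 3. Put $\beta=x_2\,dx_3+x_3\,dx_2$ and $X=\dfrac{x_2\partial_3+x_3\partial_2}{x_2^2+x_3^2}$. There are isomorphisms of $I(\Omega)$-modules $$H^0_\Lambda(\Omega)\cong I(\Omega),\qquad H^1_\Lambda(\Omega)\cong H^1_{\Lambda,tan}(\Omega)\oplus I(\Omega)X,\qquad H^2_\Lambda(\Omega)\cong H^1_{\Lambda,tan}(\Omega),$$ and the second one can be chosen so that it sends the class of a tangential cocycle $A$ to $([A],0)$, and so that the component in $I(\Omega)X$ of the image of a class $[Q]$ is the transverse part $\beta(Q)X$ of $Q$. In particular $H^1_\Lambda(\Omega)$ and $H^2_\Lambda(\Omega)$ are infinite dimensional. Moreover $H^k_\Lambda(\Omega)=0$ for all $k\ge 3$. 4. Let $a,g\in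 C^\infty(\Omega)$ depend only on $(x_2,x_3)$ and satisfy $H_{x_1}g=a$. For $u>0$ and $v\in\mathbb R$ let $\varphi(u,v)$ be the unique point $(x_2,x_3)$ with $x_2,x_3>0$, $x_2x_3=u$ and $\tfrac12(x_2^2-x_3^2)=v$. Then, with $A=a\circ\varphi$, the limit $$\lim_{u\to0^+}\int_{-1}^{1}\frac{A(u,t)}{2\sqrt{u^2+t^2}}\,dt$$ exists in $\mathbb R$. -/

import Mathlib

open scoped ContDiff

set_option maxSynthPendingDepth 3

namespace LiePoissonH

/-! ### The Lie algebra and its dual -/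

/-- The three-dimensional real Lie algebra with basis `X₁, X₂, X₃` and brackets
`[X₁, X₂] = X₂`, `[X₁, X₃] = -X₃`, `[X₂, X₃] = 0`. An element is its coordinate vector with
respect to that basis; indices are shifted by one, so `i : Fin 3` is the index of `X_{i+1}`. -/
def 𝔥 : Type := Fin 3 → ℝ

instance : NormedAddCommGroup 𝔥 := inferInstanceAs (NormedAddCommGroup (Fin 3 → ℝ))

noncomputable instance : NormedSpace ℝ 𝔥 := inferInstanceAs (NormedSpace ℝ (Fin 3 → ℝ))

instance : FiniteDimensional ℝ 𝔥 := inferInstanceAs (FiniteDimensional ℝ (Fin 3 → ℝ))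

@[ext] theorem 𝔥.ext {a b : 𝔥} (h : ∀ i, a i = b i) : a = b := funext h

@[simp] theorem 𝔥.add_apply (a b : 𝔥) (i : Fin 3) : (a + b) i = a i + b i := rfl

@[simp] theorem 𝔥.neg_apply (a : 𝔥) (i : Fin 3) : (-a) i = -a i := rfl

@[simp] theorem 𝔥.zero_apply (i : Fin 3) : (0 : 𝔥) i = 0 := rfl

@[simp] theorem 𝔥.smul_apply (c : ℝ) (a : 𝔥) (i : Fin 3) : (c • a) i = c * a i := rfl

noncomputable instance : Bracket 𝔥 𝔥 :=
  ⟨fun a b => ![0, a 0 * b 1 - a 1 * b 0, -(a 0 * b 2 - a 2 * b 0)]⟩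

@[simp] theorem bracket_zero_apply (a b : 𝔥) : ⁅a, b⁆ 0 = 0 := rfl

@[simp] theorem bracket_one_apply (a b : 𝔥) : ⁅a, b⁆ 1 = a 0 * b 1 - a 1 * b 0 := rfl

@[simp] theorem bracket_two_apply (a b : 𝔥) : ⁅a, b⁆ 2 = -(a 0 * b 2 - a 2 * b 0) := rfl

noncomputable instance : LieRing 𝔥 where
  add_lie a b c := by ext i; fin_cases i <;> simp <;> ring
  lie_add a b c := by ext i; fin_cases i <;> simp <;> ring
  lie_self a := by ext i; fin_cases i <;> simp <;> ring
  leibniz_lie a b c := by ext i; fin_cases i <;> simp <;> ring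

noncomputable instance : LieAlgebra ℝ 𝔥 where
  lie_smul t a b := by ext i; fin_cases i <;> simp <;> ring

/-- The basis vectors `X₁, X₂, X₃` (as `X 0, X 1, X 2`). -/
def X (i : Fin 3) : 𝔥 := fun j => if j = i then 1 else 0

theorem bracket_basis : ⁅X 0, X 1⁆ = X 1 ∧ ⁅X 0, X 2⁆ = -X 2 ∧ ⁅X 1, X 2⁆ = 0 := by
  refine ⟨?_, ?_, ?_⟩ <;> ext i <;> fin_cases i <;> simp [X]

/-- The dual `𝔥*`, identified with `ℝ³` by the coordinates `x_i(ℓ) = ℓ(X_i)`. -/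
abbrev Dual : Type := Fin 3 → ℝ

/-- The duality pairing `⟨x, Y⟩` of `𝔥*` with `𝔥`. -/
def pairing (x : Dual) (Y : 𝔥) : ℝ := ∑ i, x i * Y i

/-- The Lie bracket as a continuous bilinear map. -/
noncomputable def lieCLM : 𝔥 →L[ℝ] 𝔥 →L[ℝ] 𝔥 :=
  LinearMap.toContinuousLinearMap
    ((LinearMap.toContinuousLinearMap (𝕜 := ℝ) (E := 𝔥) (F' := 𝔥)).toLinearMap ∘ₗ
      LinearMap.mk₂ ℝ (fun a b : 𝔥 => ⁅a, b⁆) add_lie smul_lie lie_add (fun c a b => lie_smul c a b))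

@[simp] theorem lieCLM_apply (a b : 𝔥) : lieCLM a b = ⁅a, b⁆ := rfl

/-! ### The coadjoint action -/

/-- The coadjoint representation: `(ad*_ξ x)(Y) = -⟨x, [ξ, Y]⟩`. -/
noncomputable def coad (ξ : 𝔥) : Dual →L[ℝ] Dual :=
  LinearMap.toContinuousLinearMap
    { toFun := fun x i => -pairing x ⁅ξ, X i⁆
      map_add' := fun x y => by
        ext i; simp only [pairing, Pi.add_apply, add_mul, Finset.sum_add_distrib]; ring
      map_smul' := fun c x => by
        ext i
        simp only [pairing, Pi.smul_apply, smul_eq_mul, mul_assoc, ← Finset.mul_sum,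
          RingHom.id_apply]
        ring }

/-- The coadjoint action of the group element `exp ξ`, `ξ ∈ 𝔥`. -/
noncomputable def coAd (ξ : 𝔥) : Dual →L[ℝ] Dual := NormedSpace.exp (coad ξ)

/-- The orbit of `x` under the coadjoint action of the connected and simply connected Lie group
of `𝔥`: such a group is generated by the elements `exp ξ`. -/
def coadjointOrbit (x : Dual) : Set Dual := {y | ∃ l : List 𝔥, y = (l.map coAd).prod x}

/-- The dimension of the coadjoint orbit of `x`, i.e. of its tangent space `{ad*_ξ x | ξ ∈ 𝔥}`
at `x`. -/
noncomputable def orbitDim (x : Dual) : ℕ :=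
  Module.finrank ℝ (Submodule.span ℝ (Set.range fun ξ : 𝔥 => coad ξ x))

/-- The open set `Ω = {x₂² + x₃² ≠ 0}` of `𝔥*`. -/
def Ω : Set Dual := {x | x 1 ^ 2 + x 2 ^ 2 ≠ 0}

theorem isOpen_Ω : IsOpen Ω :=
  isOpen_ne_fun (by fun_prop) continuous_const

/-! ### The Lie–Poisson structure

The cotangent space of `𝔥*` at every point is `(𝔥*)* = 𝔥`, with `dx_i = X_i`. -/

/-- The Poisson bivector `Λ_x(ξ, η) = ⟨x, [ξ, η]⟩` of `𝔥*`. -/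
noncomputable def Λ (x : Dual) (ξ η : 𝔥) : ℝ := pairing x ⁅ξ, η⁆

/-- The map `# : T*_x → T_x` with `⟨η, ξ^#⟩ = Λ_x(ξ, η)`. -/
noncomputable def sharp (x : Dual) : 𝔥 →L[ℝ] Dual :=
  LinearMap.toContinuousLinearMap
    { toFun := fun ξ i => Λ x ξ (X i)
      map_add' := fun a b => by
        ext i; simp only [Λ, pairing, add_lie, 𝔥.add_apply, mul_add, Finset.sum_add_distrib,
          Pi.add_apply]
      map_smul' := fun c a => by
        ext i
        simp only [Λ, pairing, smul_lie, 𝔥.smul_apply, Pi.smul_apply, smul_eq_mul,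
          RingHom.id_apply, Finset.mul_sum]
        exact Finset.sum_congr rfl fun j _ => by ring }

theorem sharp_apply (x : Dual) (ξ : 𝔥) (i : Fin 3) : sharp x ξ i = Λ x ξ (X i) := rfl

theorem sharp_smooth : ContDiff ℝ ∞ sharp := by
  have h : sharp = LinearMap.toContinuousLinearMap (𝕜 := ℝ) (E := Dual) (F' := 𝔥 →L[ℝ] Dual)
      { toFun := sharp
        map_add' := fun x y => by
          ext ξ i
          simp [sharp_apply, Λ, pairing, add_mul, Finset.sum_add_distrib]
        map_smul' := fun c x => by
          ext ξ i
          simp [sharp_apply, Λ, pairing, Finset.mul_sum, mul_assoc] } := rfl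
  rw [h]
  exact ContinuousLinearMap.contDiff _

/-! ### Smooth maps on `Ω` -/

/-- Extension by zero, used only to differentiate at points of the open set `Ω`. -/
noncomputable def ext0 {W : Type*} [Zero W] (Q : Ω → W) : Dual → W :=
  Function.extend Subtype.val Q 0

@[simp] theorem ext0_coe {W : Type*} [Zero W] (Q : Ω → W) (x : Ω) : ext0 Q x = Q x :=
  Subtype.val_injective.extend_apply Q 0 x

/-- Smoothness (`C^∞`) of a map defined on the open set `Ω`. -/
def Smooth {W : Type*} [NormedAddCommGroup W] [NormedSpace ℝ W] (Q : Ω → W) : Prop :=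
  ContDiffOn ℝ ∞ (ext0 Q) Ω

theorem Smooth.congr {W : Type*} [NormedAddCommGroup W] [NormedSpace ℝ W] {Q : Ω → W}
    {F : Dual → W} (hF : ContDiffOn ℝ ∞ F Ω) (h : ∀ x : Ω, Q x = F x) : Smooth Q :=
  ContDiffOn.congr hF fun x hx => by rw [← h ⟨x, hx⟩]; exact ext0_coe Q ⟨x, hx⟩

theorem Smooth.diffAt {W : Type*} [NormedAddCommGroup W] [NormedSpace ℝ W] {Q : Ω → W}
    (h : Smooth Q) (x : Ω) : DifferentiableAt ℝ (ext0 Q) x :=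
  (ContDiffOn.contDiffAt h (isOpen_Ω.mem_nhds x.2)).differentiableAt (by simp)

/-- The derivative at a point of `Ω`. -/
noncomputable def D {W : Type*} [NormedAddCommGroup W] [NormedSpace ℝ W] (Q : Ω → W) (x : Ω) :
    Dual →L[ℝ] W :=
  fderiv ℝ (ext0 Q) x

theorem D_eq {W : Type*} [NormedAddCommGroup W] [NormedSpace ℝ W] {Q : Ω → W} {F : Dual → W}
    (h : ∀ x : Ω, Q x = F x) (x : Ω) : D Q x = fderiv ℝ F x := by
  refine Filter.EventuallyEq.fderiv_eq ?_
  filter_upwards [isOpen_Ω.mem_nhds x.2] with y hy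
  rw [← h ⟨y, hy⟩]; exact ext0_coe Q ⟨y, hy⟩

theorem Smooth.add {W : Type*} [NormedAddCommGroup W] [NormedSpace ℝ W] {P Q : Ω → W}
    (hP : Smooth P) (hQ : Smooth Q) : Smooth (P + Q) :=
  Smooth.congr (ContDiffOn.add hP hQ) fun x => by simp

theorem Smooth.smul {W : Type*} [NormedAddCommGroup W] [NormedSpace ℝ W] {f : Ω → ℝ} {Q : Ω → W}
    (hf : Smooth f) (hQ : Smooth Q) : Smooth (f • Q) :=
  Smooth.congr (ContDiffOn.smul hf hQ) fun x => by simp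

theorem Smooth.const {W : Type*} [NormedAddCommGroup W] [NormedSpace ℝ W] (w : W) :
    Smooth (fun _ => w) :=
  Smooth.congr (F := fun _ => w) contDiffOn_const fun _ => rfl

theorem D_add {W : Type*} [NormedAddCommGroup W] [NormedSpace ℝ W] {P Q : Ω → W}
    (hP : Smooth P) (hQ : Smooth Q) (x : Ω) : D (P + Q) x = D P x + D Q x := by
  rw [D_eq (F := ext0 P + ext0 Q) (fun x => by simp)]
  exact fderiv_add (hP.diffAt x) (hQ.diffAt x)

theorem D_smul {W : Type*} [NormedAddCommGroup W] [NormedSpace ℝ W] {f : Ω → ℝ} {Q : Ω → W}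
    (hf : Smooth f) (hQ : Smooth Q) (x : Ω) :
    D (f • Q) x = f x • D Q x + (D f x).smulRight (Q x) := by
  rw [D_eq (F := fun y => ext0 f y • ext0 Q y) (fun x => by simp)]
  rw [fderiv_fun_smul (hf.diffAt x) (hQ.diffAt x)]
  simp [D]

theorem D_const {W : Type*} [NormedAddCommGroup W] [NormedSpace ℝ W] (w : W) (x : Ω) :
    D (fun _ : Ω => w) x = 0 := by
  rw [D_eq (F := fun _ => w) (fun _ => rfl)]; simp

theorem Smooth.D {W : Type*} [NormedAddCommGroup W] [NormedSpace ℝ W] {Q : Ω → W}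
    (h : Smooth Q) : Smooth (D Q) :=
  Smooth.congr (F := fderiv ℝ (ext0 Q)) (ContDiffOn.fderiv_of_isOpen h isOpen_Ω (by simp))
    fun _ => rfl

theorem Smooth.neg {W : Type*} [NormedAddCommGroup W] [NormedSpace ℝ W] {Q : Ω → W}
    (hQ : Smooth Q) : Smooth (-Q) := by
  have h := (Smooth.const (-1 : ℝ)).smul hQ
  rwa [show ((fun _ => (-1 : ℝ)) : Ω → ℝ) • Q = -Q from by ext1 x; simp] at h

theorem D_neg {W : Type*} [NormedAddCommGroup W] [NormedSpace ℝ W] {Q : Ω → W} (x : Ω) :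
    D (-Q) x = -D Q x := by
  rw [D_eq (F := -ext0 Q) (fun x => by simp)]
  exact fderiv_neg

/-- The Casimir functions on `Ω`: the smooth functions whose Hamiltonian vector field vanishes,
i.e. `df(ξ^#) = 0` for every covector `ξ`. They form the algebra `I(Ω)`. -/
@[ext] structure Cas where
  /-- the underlying function -/
  val : Ω → ℝ
  smooth : Smooth val
  casimir : ∀ (x : Ω) (ξ : 𝔥), D val x (sharp x ξ) = 0

namespace Cas

noncomputable instance : Zero Cas := ⟨⟨fun _ => 0, Smooth.const 0, fun x ξ => by simp [D_const]⟩⟩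

noncomputable instance : One Cas := ⟨⟨fun _ => 1, Smooth.const 1, fun x ξ => by simp [D_const]⟩⟩

noncomputable instance : Add Cas := ⟨fun f g => ⟨f.val + g.val, f.smooth.add g.smooth,
  fun x ξ => by simp [D_add f.smooth g.smooth, f.casimir, g.casimir]⟩⟩

noncomputable instance : Neg Cas := ⟨fun f => ⟨-f.val, f.smooth.neg,
  fun x ξ => by simp [D_neg, f.casimir]⟩⟩

noncomputable instance : Mul Cas := ⟨fun f g => ⟨f.val • g.val, f.smooth.smul g.smooth,
  fun x ξ => by rw [D_smul f.smooth g.smooth]; simp [f.casimir, g.casimir]⟩⟩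

@[simp] theorem zero_val (x : Ω) : (0 : Cas).val x = 0 := rfl

@[simp] theorem one_val (x : Ω) : (1 : Cas).val x = 1 := rfl

@[simp] theorem add_val (f g : Cas) (x : Ω) : (f + g).val x = f.val x + g.val x := rfl

@[simp] theorem neg_val (f : Cas) (x : Ω) : (-f).val x = -f.val x := rfl

@[simp] theorem mul_val (f g : Cas) (x : Ω) : (f * g).val x = f.val x * g.val x := rfl

noncomputable instance : CommRing Cas where
  add_assoc f g h := by ext x; simp [add_assoc]
  zero_add f := by ext x; simp
  add_zero f := by ext x; simp
  add_comm f g := by ext x; simp [add_comm]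
  neg_add_cancel f := by ext x; simp
  mul_assoc f g h := by ext x; simp [mul_assoc]
  one_mul f := by ext x; simp
  mul_one f := by ext x; simp
  mul_comm f g := by ext x; simp [mul_comm]
  left_distrib f g h := by ext x; simp [mul_add]
  right_distrib f g h := by ext x; simp [add_mul]
  zero_mul f := by ext x; simp
  mul_zero f := by ext x; simp
  nsmul := nsmulRec
  zsmul := zsmulRec

noncomputable instance : Algebra ℝ Cas :=
  RingHom.toAlgebra
    { toFun := fun r => ⟨fun _ => r, Smooth.const r, fun x ξ => by simp [D_const]⟩
      map_one' := rfl
      map_mul' := fun _ _ => rfl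
      map_zero' := rfl
      map_add' := fun _ _ => rfl }

@[simp] theorem algebraMap_val (r : ℝ) (x : Ω) : (algebraMap ℝ Cas r).val x = r := rfl

end Cas

/-- The ring `S(𝔥)^H` of `H`-invariant polynomial functions on `𝔥*`, acting through restriction
to `Ω`. -/
noncomputable def polyInv : Subalgebra ℝ Cas where
  carrier := {f | ∃ p : MvPolynomial (Fin 3) ℝ,
    (∀ (ξ : 𝔥) (x : Dual), MvPolynomial.eval (coAd ξ x) p = MvPolynomial.eval x p) ∧
    ∀ x : Ω, f.val x = MvPolynomial.eval x.1 p}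
  mul_mem' := by
    rintro f g ⟨p, hp, hfp⟩ ⟨q, hq, hgq⟩
    exact ⟨p * q, fun ξ x => by simp [hp, hq], fun x => by simp [hfp, hgq]⟩
  add_mem' := by
    rintro f g ⟨p, hp, hfp⟩ ⟨q, hq, hgq⟩
    exact ⟨p + q, fun ξ x => by simp [hp, hq], fun x => by simp [hfp, hgq]⟩
  algebraMap_mem' := fun r => ⟨MvPolynomial.C r, fun ξ x => by simp, fun x => by simp⟩

/-- The ring `A(𝔥)^H` of `H`-invariant real analytic functions on `𝔥*`, acting through restriction
to `Ω`. -/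
noncomputable def anaInv : Subalgebra ℝ Cas where
  carrier := {f | ∃ F : Dual → ℝ, AnalyticOnNhd ℝ F Set.univ ∧
    (∀ (ξ : 𝔥) (x : Dual), F (coAd ξ x) = F x) ∧ ∀ x : Ω, f.val x = F x}
  mul_mem' := by
    rintro f g ⟨F, hF, hF', hfF⟩ ⟨G, hG, hG', hgG⟩
    exact ⟨F * G, hF.mul hG, fun ξ x => by simp [hF', hG'], fun x => by simp [hfF, hgG]⟩
  add_mem' := by
    rintro f g ⟨F, hF, hF', hfF⟩ ⟨G, hG, hG', hgG⟩
    exact ⟨F + G, hF.add hG, fun ξ x => by simp [hF', hG'], fun x => by simp [hfF, hgG]⟩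
  algebraMap_mem' := fun r => ⟨fun _ => r, analyticOnNhd_const, fun _ _ => rfl, fun _ => rfl⟩

/-! ### Multivector fields and the Poisson coboundary -/

/-- `⋀^k T_x𝔥*`: the alternating `k`-linear forms on the cotangent space `𝔥`. -/
abbrev Fiber (k : ℕ) : Type := 𝔥 [⋀^Fin k]→L[ℝ] ℝ

/-- The smooth `k`-vector fields on `Ω`. They form the `I(Ω)`-module `V^k(Ω)`. -/
@[ext] structure V (k : ℕ) where
  /-- the underlying section -/
  val : Ω → Fiber k
  smooth : Smooth val

namespace V

variable {k : ℕ}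

noncomputable instance : Zero (V k) := ⟨⟨fun _ => 0, Smooth.const 0⟩⟩

noncomputable instance : Add (V k) := ⟨fun P Q => ⟨P.val + Q.val, P.smooth.add Q.smooth⟩⟩

noncomputable instance : Neg (V k) := ⟨fun P => ⟨-P.val, P.smooth.neg⟩⟩

noncomputable instance : SMul Cas (V k) := ⟨fun f P => ⟨f.val • P.val, f.smooth.smul P.smooth⟩⟩

@[simp] theorem zero_val (x : Ω) : (0 : V k).val x = 0 := rfl

@[simp] theorem add_val (P Q : V k) (x : Ω) : (P + Q).val x = P.val x + Q.val x := rfl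

@[simp] theorem neg_val (P : V k) (x : Ω) : (-P).val x = -P.val x := rfl

@[simp] theorem smul_val (f : Cas) (P : V k) (x : Ω) : (f • P).val x = f.val x • P.val x := rfl

theorem ext_val {P Q : V k} (h : ∀ x, P.val x = Q.val x) : P = Q := V.ext (funext h)

noncomputable instance : AddCommGroup (V k) where
  add_assoc P Q R := ext_val fun x => by simp [add_assoc]
  zero_add P := ext_val fun x => by simp
  add_zero P := ext_val fun x => by simp
  add_comm P Q := ext_val fun x => by simp [add_comm]
  neg_add_cancel P := ext_val fun x => by simp
  nsmul := nsmulRec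
  zsmul := zsmulRec

noncomputable instance : Module Cas (V k) where
  one_smul P := ext_val fun x => by simp
  mul_smul f g P := ext_val fun x => by simp [mul_smul]
  smul_zero f := ext_val fun x => by simp
  smul_add f P Q := ext_val fun x => by simp
  add_smul f g P := ext_val fun x => by simp [add_smul]
  zero_smul P := ext_val fun x => by simp

end V

/-- The part of the coboundary that does not differentiate `Q`:
`(v₀, …, v_k) ↦ ∑_{i<j} (-1)^{i+j} Q([v_i, v_j], v₀, …, v̂_i, …, v̂_j, …, v_k)`. -/
noncomputable def bracketTerm : (k : ℕ) → Fiber k →L[ℝ] Fiber (k + 1)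
  | 0 => 0
  | (m + 1) =>
    let c : Fiber (m + 1) →L[ℝ] 𝔥 →L[ℝ] Fiber m :=
      ContinuousAlternatingMap.curryLeftLI.toContinuousLinearMap
    let p : (𝔥 →L[ℝ] Fiber m) →L[ℝ] 𝔥 →L[ℝ] 𝔥 →L[ℝ] Fiber m :=
      (ContinuousLinearMap.compL ℝ 𝔥 (𝔥 →L[ℝ] 𝔥) (𝔥 →L[ℝ] Fiber m)).flip lieCLM ∘L
        ContinuousLinearMap.compL ℝ 𝔥 𝔥 (Fiber m)
    let a : (𝔥 →L[ℝ] 𝔥 →L[ℝ] Fiber m) →L[ℝ] Fiber (m + 2) :=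
      ContinuousAlternatingMap.alternatizeUncurryFinCLM ℝ 𝔥 ℝ ∘L
        ContinuousLinearMap.compL ℝ 𝔥 (𝔥 →L[ℝ] Fiber m) (Fiber (m + 1))
          (ContinuousAlternatingMap.alternatizeUncurryFinCLM ℝ 𝔥 ℝ)
    (-(1 / 2 : ℝ)) • (a ∘L p ∘L c)

theorem bracketTerm_zero : bracketTerm 0 = 0 := rfl

/-- Pairs `i < j` of indices in `Fin (m + 2)` are written `(i.castSucc, j.succ)` with `i ≤ j` in
`Fin (m + 1)`, whence the sign. -/
theorem bracketTerm_succ (m : ℕ) (Q : Fiber (m + 1)) (v : Fin (m + 2) → 𝔥) :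
    bracketTerm (m + 1) Q v =
      -∑ i : Fin (m + 1), ∑ j ≥ i, (-1 : ℝ) ^ (i + j : ℕ) *
        Q (Matrix.vecCons ⁅v i.castSucc, v j.succ⁆ (j.removeNth (i.castSucc.removeNth v))) := by
  have h (a b : 𝔥) (w : Fin m → 𝔥) :
      Q (Matrix.vecCons ⁅a, b⁆ w) = -Q (Matrix.vecCons ⁅b, a⁆ w) := by
    have := congrArg (fun f => f w) (map_neg Q.curryLeft ⁅b, a⁆)
    simp only [ContinuousAlternatingMap.neg_apply, lie_skew,
      ContinuousAlternatingMap.curryLeft_apply_apply] at this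
    exact this
  have e : bracketTerm (m + 1) Q = -(1 / 2 : ℝ) • ContinuousAlternatingMap.alternatizeUncurryFin
        (ContinuousAlternatingMap.alternatizeUncurryFinCLM ℝ 𝔥 ℝ ∘L
          (ContinuousLinearMap.compL ℝ 𝔥 𝔥 (Fiber m) Q.curryLeft ∘L lieCLM)) := rfl
  rw [e, ContinuousAlternatingMap.smul_apply,
    ContinuousAlternatingMap.alternatizeUncurryFin_alternatizeUncurryFinCLM_comp_apply,
    Finset.smul_sum, ← Finset.sum_neg_distrib]
  refine Finset.sum_congr rfl fun i _ => ?_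
  rw [Finset.smul_sum, ← Finset.sum_neg_distrib]
  refine Finset.sum_congr rfl fun j _ => ?_
  simp
  rw [h (v j.succ)]
  ring

/-- The value at `x` of the Poisson coboundary `σ Q = [Λ, Q]`, through the Koszul formula
`σQ(α₀, …, α_k) = ∑ (-1)^i α_i^#(Q(α₀, …, α̂_i, …, α_k))
  + ∑_{i<j} (-1)^{i+j} Q({α_i, α_j}, α₀, …, α̂_i, …, α̂_j, …, α_k)`.
Both sides are tensorial in the one-forms, so it is enough to take them constant, and for the
constant one-forms `ξ, η ∈ 𝔥` one has `{ξ, η} = d(Λ(ξ, η)) = [ξ, η]`.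
See `sigmaAt_zero` and `sigmaAt_succ` for the resulting expressions. -/
noncomputable def sigmaAt (k : ℕ) (Q : Ω → Fiber k) (x : Ω) : Fiber (k + 1) :=
  ContinuousAlternatingMap.alternatizeUncurryFin (D Q x ∘L sharp x) + bracketTerm k (Q x)

theorem sigmaAt_zero (Q : Ω → Fiber 0) (x : Ω) (v : Fin 1 → 𝔥) :
    sigmaAt 0 Q x v = D Q x (sharp x (v 0)) ![] := by
  simp only [sigmaAt, bracketTerm_zero, ContinuousAlternatingMap.alternatizeUncurryFin_apply,
    zero_apply, add_zero]
  have h : Fin.removeNth 0 v = ![] := Subsingleton.elim _ _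
  simp [h]

theorem sigmaAt_succ (k : ℕ) (Q : Ω → Fiber (k + 1)) (x : Ω) (v : Fin (k + 2) → 𝔥) :
    sigmaAt (k + 1) Q x v =
      ∑ i : Fin (k + 2), (-1 : ℝ) ^ (i : ℕ) * D Q x (sharp x (v i)) (i.removeNth v) -
      ∑ i : Fin (k + 1), ∑ j ≥ i, (-1 : ℝ) ^ (i + j : ℕ) *
        Q x (Matrix.vecCons ⁅v i.castSucc, v j.succ⁆ (j.removeNth (i.castSucc.removeNth v))) := by
  rw [sigmaAt, ContinuousAlternatingMap.add_apply, bracketTerm_succ,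
    ContinuousAlternatingMap.alternatizeUncurryFin_apply, ← sub_eq_add_neg]
  simp

theorem sigmaAt_smooth (k : ℕ) {Q : Ω → Fiber k} (hQ : Smooth Q) : Smooth (sigmaAt k Q) := by
  refine Smooth.congr (F := fun x =>
    ContinuousAlternatingMap.alternatizeUncurryFinCLM ℝ 𝔥 ℝ (ext0 (D Q) x ∘L sharp x) +
      bracketTerm k (ext0 Q x)) ?_ fun x => by simp [sigmaAt]
  refine ContDiffOn.add ?_ ?_
  · exact (ContinuousLinearMap.contDiff _).comp_contDiffOn
      (ContDiffOn.clm_comp hQ.D sharp_smooth.contDiffOn)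
  · exact (bracketTerm k).contDiff.comp_contDiffOn hQ

/-- The Poisson coboundary operator `σ : V^k(Ω) → V^{k+1}(Ω)`; it is linear over the Casimirs. -/
noncomputable def sigma (k : ℕ) : V k →ₗ[Cas] V (k + 1) where
  toFun Q := ⟨sigmaAt k Q.val, sigmaAt_smooth k Q.smooth⟩
  map_add' P Q := V.ext_val fun x => by
    change sigmaAt k (P.val + Q.val) x = sigmaAt k P.val x + sigmaAt k Q.val x
    simp only [sigmaAt, D_add P.smooth Q.smooth, ContinuousLinearMap.add_comp, Pi.add_apply,
      map_add, ContinuousAlternatingMap.alternatizeUncurryFin_add]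
    abel
  map_smul' f Q := V.ext_val fun x => by
    change sigmaAt k (f.val • Q.val) x = f.val x • sigmaAt k Q.val x
    have h : (D f.val x).smulRight (Q.val x) ∘L sharp x = 0 := by
      ext1 ξ
      simp [f.casimir x ξ]
    simp only [sigmaAt, D_smul f.smooth Q.smooth, ContinuousLinearMap.add_comp, h, add_zero,
      ContinuousLinearMap.smul_comp, Pi.smul_apply', map_smul, smul_add,
      ContinuousAlternatingMap.alternatizeUncurryFin_smul]

@[simp] theorem sigma_val (k : ℕ) (Q : V k) : (sigma k Q).val = sigmaAt k Q.val := rfl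

/-! ### Poisson cohomology and tangential Poisson cohomology -/

/-- Poisson `k`-cocycles. -/
noncomputable def cocycles (k : ℕ) : Submodule Cas (V k) := LinearMap.ker (sigma k)

/-- Poisson `k`-coboundaries. -/
noncomputable def coboundaries : (k : ℕ) → Submodule Cas (V k)
  | 0 => ⊥
  | (k + 1) => LinearMap.range (sigma k)

/-- The Poisson cohomology space `H^k_Λ(Ω) = ker σ / im σ`, a module over `I(Ω)`. -/
abbrev H (k : ℕ) : Type := cocycles k ⧸ (coboundaries k).submoduleOf (cocycles k)

/-- The class of a Poisson cocycle. -/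
noncomputable def H.mk {k : ℕ} (Q : cocycles k) : H k := Submodule.Quotient.mk Q

/-- The tangential `k`-vector fields, i.e. the sections of `⋀^k TF`, `F` the symplectic foliation.
As `T_xF` is the image of `#_x`, whose annihilator is the kernel of `#_x`, a `k`-vector at `x` lies
in `⋀^k T_xF` if and only if it vanishes as soon as one of its arguments lies in that kernel. -/
noncomputable def Vtan (k : ℕ) : Submodule Cas (V k) where
  carrier := {Q | ∀ (x : Ω) (v : Fin k → 𝔥), (∃ i, sharp x (v i) = 0) → Q.val x v = 0}
  add_mem' := by
    intro P Q hP hQ x v hv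
    simp [hP x v hv, hQ x v hv]
  zero_mem' := fun _ _ _ => by simp
  smul_mem' := fun f Q hQ x v hv => by simp [hQ x v hv]

/-- Tangential `k`-cocycles. -/
noncomputable def cocyclesTan (k : ℕ) : Submodule Cas (V k) := cocycles k ⊓ Vtan k

/-- Coboundaries of tangential multivector fields. -/
noncomputable def coboundariesTan : (k : ℕ) → Submodule Cas (V k)
  | 0 => ⊥
  | (k + 1) => (Vtan k).map (sigma k)

/-- The tangential Poisson cohomology space `H^k_{Λ,tan}(Ω)`, a module over `I(Ω)`: the cohomology
of the restriction of `σ` to tangential multivector fields. -/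
abbrev Htan (k : ℕ) : Type := cocyclesTan k ⧸ (coboundariesTan k).submoduleOf (cocyclesTan k)

/-- The class of a tangential cocycle. -/
noncomputable def Htan.mk {k : ℕ} (Q : cocyclesTan k) : Htan k := Submodule.Quotient.mk Q

/-- A tangential cocycle as a Poisson cocycle. -/
noncomputable def tanIncl (k : ℕ) : cocyclesTan k →ₗ[Cas] cocycles k :=
  Submodule.inclusion inf_le_left

/-- "Infinite dimensional": infinite dimensional as a real vector space, and finitely generated
neither over `S(𝔥)^H` nor over `A(𝔥)^H`. -/
def IsInfDim (M : Type) [AddCommGroup M] [Module Cas M] : Prop :=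
  ¬ Module.Finite ℝ (RestrictScalars ℝ Cas M) ∧ ¬ Module.Finite polyInv M ∧ ¬ Module.Finite anaInv M

/-! ### The transverse vector field -/

/-- The value at `x` of the one-form `β = x₂ dx₃ + x₃ dx₂`. -/
noncomputable def beta (x : Dual) : 𝔥 := x 1 • X 2 + x 2 • X 1

/-- The constant vector field `∂_i`. -/
noncomputable def del (i : Fin 3) : Fiber 1 :=
  ContinuousAlternatingMap.ofSubsingleton ℝ 𝔥 ℝ (0 : Fin 1)
    (LinearMap.toContinuousLinearMap
      { toFun := fun ξ => ξ i
        map_add' := fun _ _ => rfl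
        map_smul' := fun _ _ => rfl })

/-- The value at `x` of the vector field `(x₂ ∂₃ + x₃ ∂₂) / (x₂² + x₃²)`. -/
noncomputable def transvAt (x : Dual) : Fiber 1 :=
  (x 1 ^ 2 + x 2 ^ 2)⁻¹ • (x 1 • del 2 + x 2 • del 1)

theorem transvAt_smooth : ContDiffOn ℝ ∞ transvAt Ω := by
  refine ContDiffOn.smul (ContDiffOn.inv (by fun_prop) fun x hx => hx) (by fun_prop)

/-- The vector field `(x₂ ∂₃ + x₃ ∂₂) / (x₂² + x₃²)` on `Ω`, transverse to the symplectic
foliation. -/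
noncomputable def transv : V 1 := ⟨fun x => transvAt x, Smooth.congr transvAt_smooth fun _ => rfl⟩

/-! ### A parametrization of the quadrant `x₂, x₃ > 0` -/

/-- The inverse of `(x₂, x₃) ↦ (x₂ x₃, (x₂² - x₃²) / 2)` on the quadrant `x₂, x₃ > 0`, where
`u > 0`. -/
noncomputable def phi (u v : ℝ) : ℝ × ℝ :=
  if 0 < v then (√(v + √(u ^ 2 + v ^ 2)), u / √(v + √(u ^ 2 + v ^ 2)))
  else if v < 0 then (u / √(-v + √(u ^ 2 + v ^ 2)), √(-v + √(u ^ 2 + v ^ 2)))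
  else (√u, √u)

end LiePoissonH

/-!
The one-form `β = d(x₂x₃)` is closed and `#β = 0`, so contraction with `β` anticommutes with `σ`,
and its kernel consists of the tangential fields. Since `β` does not vanish on `Ω` and is dual to
`transv`, contraction gives a short exact sequence `0 → V_tan → V → V_tan[-1] → 0` of complexes,
split degreewise by the wedge product with `transv`. The leaves are two-dimensional, and every
tangential bivector field is `σ(a ∂₁)` for some `a`, found by integrating in `x₁` (each line
parallel to the `x₁`-axis that meets `Ω` lies in `Ω`). Hence `H^k_tan = 0` for `k ≥ 2`, and the
long exact sequence collapses to `H^{k+2} ≅ H^{k+1}_tan` and `0 → H¹_tan → H¹ → H⁰_tan → 0`.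

For infinite dimensionality, follow the flow lines `t ↦ (0, e^{t-s}, e^{-t-s})`, `|t| ≤ s`, of
`H_{x₁}`: as `s → ∞` their endpoints converge in `Ω` although the lines become infinitely long.
Integrals of coboundaries along them are therefore bounded, Casimirs are constant on each of them
with bounded values, and finitely many generators would impose a common growth rate `B(s)` on the
integrals of all cocycles. The cocycles `K(log(x₂² + x₃²)) ∂₁` violate every such bound. The
integral in the last part is, in the same way, the difference of the values of `g` at two endpoints
that converge in `Ω`.
-/

namespace LiePoissonH

/-! ### Smooth parametric integrals -/

section ParametricIntegral

open Set MeasureTheory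

universe u

theorem hasFDerivAt_intervalIntegral_of_contDiffOn {E F : Type*} [NormedAddCommGroup E]
    [NormedSpace ℝ E] [ProperSpace E] [NormedAddCommGroup F] [NormedSpace ℝ F] {U : Set E}
    (hU : IsOpen U) {f : E × ℝ → F} (hf : ContDiffOn ℝ 1 f (U ×ˢ univ)) (a b : ℝ) {x : E}
    (hx : x ∈ U) :
    HasFDerivAt (fun y => ∫ s in a..b, f (y, s))
      (∫ s in a..b, fderiv ℝ f (x, s) ∘L ContinuousLinearMap.inl ℝ E ℝ) x := by
  have hO : IsOpen (U ×ˢ (univ : Set ℝ)) := hU.prod isOpen_univ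
  have hf' : ContinuousOn (fun q => fderiv ℝ f q ∘L ContinuousLinearMap.inl ℝ E ℝ) (U ×ˢ univ) :=
    (hf.continuousOn_fderiv_of_isOpen hO le_rfl).clm_comp continuousOn_const
  obtain ⟨ε, hε, hεU⟩ := Metric.nhds_basis_closedBall.mem_iff.1 (hU.mem_nhds hx)
  obtain ⟨C, hC⟩ := ((isCompact_closedBall x ε).prod (isCompact_uIcc (a := a) (b := b))
    ).exists_bound_of_continuousOn (hf'.mono fun q hq => ⟨hεU hq.1, trivial⟩)
  have hslice : ∀ y ∈ U, Continuous fun s : ℝ => f (y, s) := fun y hy =>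
    hf.continuousOn.comp_continuous (by fun_prop) fun s => ⟨hy, trivial⟩
  have hslice' : Continuous fun s : ℝ => fderiv ℝ f (x, s) ∘L ContinuousLinearMap.inl ℝ E ℝ :=
    hf'.comp_continuous (f := fun s : ℝ => (x, s)) (by fun_prop) fun s => ⟨hx, trivial⟩
  refine intervalIntegral.hasFDerivAt_integral_of_dominated_of_fderiv_le
    (F := fun y s => f (y, s)) (bound := fun _ => C)
    (F' := fun y s => fderiv ℝ f (y, s) ∘L ContinuousLinearMap.inl ℝ E ℝ)
    (Metric.closedBall_mem_nhds x hε) ?_ ((hslice x hx).intervalIntegrable a b)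
    hslice'.aestronglyMeasurable (.of_forall fun s hs y hy => hC (y, s) ⟨hy, uIoc_subset_uIcc hs⟩)
    intervalIntegrable_const (.of_forall fun s _ y hy => ?_)
  · filter_upwards [hU.mem_nhds hx] with y hy using (hslice y hy).aestronglyMeasurable
  · have hfy : DifferentiableAt ℝ f (y, s) :=
      (hf.contDiffAt (hO.mem_nhds ⟨hεU hy, trivial⟩)).differentiableAt one_ne_zero
    exact hfy.hasFDerivAt.comp y (hasFDerivAt_prodMk_left y s)

theorem contDiffOn_nat_intervalIntegral {E : Type u} [NormedAddCommGroup E] [NormedSpace ℝ E]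
    [ProperSpace E] {U : Set E} (hU : IsOpen U) (a b : ℝ) (n : ℕ) :
    ∀ {F : Type u} [NormedAddCommGroup F] [NormedSpace ℝ F] {f : E × ℝ → F},
      ContDiffOn ℝ (n + 1 : ℕ) f (U ×ˢ univ) →
      ContDiffOn ℝ n (fun x => ∫ s in a..b, f (x, s)) U := by
  induction n with
  | zero =>
    intro F _ _ f hf
    rw [Nat.cast_zero, contDiffOn_zero]
    exact fun x hx => (hasFDerivAt_intervalIntegral_of_contDiffOn hU (by simpa using hf) a b
      hx).continuousAt.continuousWithinAt
  | succ n ih =>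
    intro F _ _ f hf
    have hf1 : ContDiffOn ℝ 1 f (U ×ˢ univ) :=
      hf.of_le (by exact_mod_cast Nat.le_add_left 1 (n + 1))
    have hf' : ContDiffOn ℝ (n + 1 : ℕ)
        (fun q => fderiv ℝ f q ∘L ContinuousLinearMap.inl ℝ E ℝ) (U ×ˢ univ) :=
      (hf.fderiv_of_isOpen (hU.prod isOpen_univ) (by norm_cast)).clm_comp contDiffOn_const
    rw [Nat.cast_add, Nat.cast_one,
      contDiffOn_succ_iff_hasFDerivWithinAt_of_uniqueDiffOn hU.uniqueDiffOn]
    exact ⟨by simp, _, ih hf', fun x hx =>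
      (hasFDerivAt_intervalIntegral_of_contDiffOn hU hf1 a b hx).hasFDerivWithinAt⟩

theorem contDiffOn_intervalIntegral {E F : Type u} [NormedAddCommGroup E] [NormedSpace ℝ E]
    [ProperSpace E] [NormedAddCommGroup F] [NormedSpace ℝ F] {U : Set E} (hU : IsOpen U)
    {f : E × ℝ → F} (hf : ContDiffOn ℝ ∞ f (U ×ˢ univ)) (a b : ℝ) :
    ContDiffOn ℝ ∞ (fun x => ∫ s in a..b, f (x, s)) U :=
  contDiffOn_infty.2 fun n => contDiffOn_nat_intervalIntegral hU a b n (contDiffOn_infty.1 hf _)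

end ParametricIntegral

/-! ### Calculus on `Ω` -/

section Calculus

variable {W W' : Type*} [NormedAddCommGroup W] [NormedSpace ℝ W] [NormedAddCommGroup W']
  [NormedSpace ℝ W'] {Q : Ω → W}

theorem Smooth.clm (hQ : Smooth Q) (L : W →L[ℝ] W') : Smooth fun x => L (Q x) :=
  Smooth.congr (L.contDiff.comp_contDiffOn hQ) fun x => by simp

theorem D_clm (hQ : Smooth Q) (L : W →L[ℝ] W') (x : Ω) : D (fun y => L (Q y)) x = L ∘L D Q x := by
  rw [D_eq (F := fun y => L (ext0 Q y)) (fun y => by simp)]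
  exact fderiv_comp x.1 L.differentiableAt (hQ.diffAt x) |>.trans (by simp [D])

theorem Smooth.continuous (hQ : Smooth Q) : Continuous Q := by
  rw [← funext (ext0_coe Q)]
  exact (ContDiffOn.continuousOn hQ).comp_continuous continuous_subtype_val Subtype.prop

theorem hasDerivAt_smooth_comp (hQ : Smooth Q) {c : ℝ → Ω} {c' : Dual} {t : ℝ}
    (hc : HasDerivAt (fun s => (c s : Dual)) c' t) :
    HasDerivAt (fun s => Q (c s)) (D Q (c t) c') t := by
  have h := (hQ.diffAt (c t)).hasFDerivAt.comp_hasDerivAt t hc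
  exact h.congr_of_eventuallyEq (.of_forall fun s => (ext0_coe Q (c s)).symm)

end Calculus

/-- The point of `𝔥*` with coordinates `x₁ = p`, `x₂ = y`, `x₃ = z`. -/
def pt (p y z : ℝ) : Dual := ![p, y, z]

theorem pt_mem_Ω {p y z : ℝ} : pt p y z ∈ Ω ↔ y ^ 2 + z ^ 2 ≠ 0 := by simp [pt, Ω]

theorem pt_eta (x : Dual) : pt (x 0) (x 1) (x 2) = x := by ext i; fin_cases i <;> rfl

theorem contDiff_pt {E : Type*} [NormedAddCommGroup E] [NormedSpace ℝ E] {n : WithTop ℕ∞}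
    {p y z : E → ℝ} (hp : ContDiff ℝ n p) (hy : ContDiff ℝ n y) (hz : ContDiff ℝ n z) :
    ContDiff ℝ n fun e => pt (p e) (y e) (z e) := by
  refine contDiff_pi.2 fun i => ?_
  fin_cases i
  exacts [hp, hy, hz]

theorem hasDerivAt_pt {p y z : ℝ → ℝ} {p' y' z' t : ℝ} (hp : HasDerivAt p p' t)
    (hy : HasDerivAt y y' t) (hz : HasDerivAt z z' t) :
    HasDerivAt (fun s => pt (p s) (y s) (z s)) (pt p' y' z') t := by
  refine hasDerivAt_pi.2 fun i => ?_
  fin_cases i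
  exacts [hp, hy, hz]

/-- The constant vector `∂₁`, as an element of the tangent space `𝔥*`. -/
def e₀ : Dual := pt 1 0 0

/-- The line through `x` in the direction `∂₁`, parametrized by `x₁`. -/
def axisLine (x : Ω) (s : ℝ) : Ω := ⟨pt s (x.1 1) (x.1 2), pt_mem_Ω.2 x.2⟩

theorem axisLine_self (x : Ω) : axisLine x (x.1 0) = x := Subtype.ext (pt_eta x)

theorem hasDerivAt_axisLine (x : Ω) (s : ℝ) :
    HasDerivAt (fun r => (axisLine x r : Dual)) e₀ s :=
  hasDerivAt_pt (hasDerivAt_id s) (hasDerivAt_const s _) (hasDerivAt_const s _)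

theorem exists_smooth_primitive {f : Ω → ℝ} (hf : Smooth f) :
    ∃ F : Ω → ℝ, Smooth F ∧ ∀ x, D F x e₀ = f x := by
  let G : Dual → ℝ := fun x => x 0 * ∫ s in (0 : ℝ)..1, ext0 f (pt (s * x 0) (x 1) (x 2))
  have hG : ContDiffOn ℝ ∞ G Ω := by
    refine ContDiffOn.mul (by fun_prop) (contDiffOn_intervalIntegral isOpen_Ω
      (f := fun q : Dual × ℝ => ext0 f (pt (q.2 * q.1 0) (q.1 1) (q.1 2))) ?_ 0 1)
    exact ContDiffOn.comp hf (contDiff_pt (by fun_prop) (by fun_prop) (by fun_prop)).contDiffOn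
      fun q hq => pt_mem_Ω.2 hq.1
  have hS : Smooth fun x : Ω => G x := Smooth.congr hG fun _ => rfl
  refine ⟨_, hS, fun x => ?_⟩
  have hcont : Continuous fun s => f (axisLine x s) :=
    hf.continuous.comp (.subtype_mk
      (continuous_iff_continuousAt.2 fun s => (hasDerivAt_axisLine x s).continuousAt) _)
  have hint : ∀ s, G (axisLine x s) = ∫ r in (0 : ℝ)..s, f (axisLine x r) := fun s => by
    have hscale := intervalIntegral.smul_integral_comp_mul_right (a := 0) (b := 1)
      (fun r => f (axisLine x r)) s
    rw [zero_mul, one_mul] at hscale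
    rw [← hscale]
    exact congrArg (s * ·)
      (intervalIntegral.integral_congr fun r _ => ext0_coe f (axisLine x (r * s)))
  have hderiv := (hasDerivAt_smooth_comp hS (hasDerivAt_axisLine x (x.1 0))).unique
    ((hcont.integral_hasStrictDerivAt 0 (x.1 0)).hasDerivAt.congr_of_eventuallyEq
      (.of_forall hint))
  rwa [axisLine_self] at hderiv

/-! ### The map `#` and the one-form `β` -/

theorem sharp_eq (x : Dual) (ξ : 𝔥) :
    sharp x ξ = pt (-(ξ 1 * x 1) + ξ 2 * x 2) (ξ 0 * x 1) (-(ξ 0 * x 2)) := by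
  ext i
  rw [sharp_apply]
  fin_cases i <;> simp [Λ, pairing, Fin.sum_univ_three, X, pt] <;> ring

theorem sharp_X_zero (x : Dual) : sharp x (X 0) = pt 0 (x 1) (-x 2) := by
  rw [sharp_eq]; simp [X]

@[simp] theorem beta_apply_zero (x : Dual) : beta x 0 = 0 := by simp [beta, X]

@[simp] theorem beta_apply_one (x : Dual) : beta x 1 = x 2 := by simp [beta, X]

@[simp] theorem beta_apply_two (x : Dual) : beta x 2 = x 1 := by simp [beta, X]

@[simp] theorem sharp_beta (x : Dual) : sharp x (beta x) = 0 := by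
  rw [sharp_eq]; ext i; fin_cases i <;> simp [pt]; ring

theorem ker_sharp {x : Dual} (hx : x ∈ Ω) :
    LinearMap.ker (sharp x : 𝔥 →ₗ[ℝ] Dual) = Submodule.span ℝ {beta x} := by
  have hx : x 1 ^ 2 + x 2 ^ 2 ≠ 0 := hx
  refine le_antisymm (fun ξ hξ => Submodule.mem_span_singleton.2
    ⟨(ξ 1 * x 2 + ξ 2 * x 1) / (x 1 ^ 2 + x 2 ^ 2), ?_⟩)
    ((Submodule.span_singleton_le_iff_mem _ _).2 (sharp_beta x))
  have hξ : pt (-(ξ 1 * x 1) + ξ 2 * x 2) (ξ 0 * x 1) (-(ξ 0 * x 2)) = 0 := sharp_eq x ξ ▸ hξ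
  have h0 : -(ξ 1 * x 1) + ξ 2 * x 2 = 0 := congrFun hξ 0
  have h1 : ξ 0 * x 1 = 0 := congrFun hξ 1
  have h2 : -(ξ 0 * x 2) = 0 := congrFun hξ 2
  have h3 : ξ 0 * (x 1 ^ 2 + x 2 ^ 2) = 0 := by linear_combination x 1 * h1 - x 2 * h2
  ext i
  fin_cases i
  · simpa using ((mul_eq_zero.1 h3).resolve_right hx).symm
  · simp; field_simp; linear_combination x 1 * h0
  · simp; field_simp; linear_combination -x 2 * h0

/-- `x ↦ β_x` as a linear map. -/
noncomputable def betaCLM : Dual →L[ℝ] 𝔥 :=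
  LinearMap.toContinuousLinearMap
    { toFun := beta
      map_add' := fun a b => by ext i; fin_cases i <;> simp
      map_smul' := fun c a => by ext i; fin_cases i <;> simp }

theorem beta_sharp (x : Dual) (ξ : 𝔥) : beta (sharp x ξ) = -⁅ξ, beta x⁆ := by
  rw [sharp_eq]; ext i; fin_cases i <;> simp [pt]

/-- The coframe `dx₁, γ, β` of `Ω`, where `γ = x₂ dx₂ - x₃ dx₃`. The map `#` kills `β` and sends
`dx₁, γ` to the vectors `H_{x₁}, -(x₂² + x₃²) ∂₁`, which span the tangent space of the leaf. -/
noncomputable def coframe (x : Dual) : Fin 3 → 𝔥 := ![X 0, x 1 • X 1 - x 2 • X 2, beta x]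

theorem sharp_coframe_one (x : Dual) : sharp x (coframe x 1) = -(x 1 ^ 2 + x 2 ^ 2) • e₀ := by
  rw [sharp_eq]
  ext i
  fin_cases i <;> simp [coframe, X, pt, e₀, sub_eq_add_neg]
  ring

theorem linearIndependent_coframe {x : Dual} (hx : x ∈ Ω) :
    LinearIndependent ℝ (coframe x) := by
  have hx : x 1 ^ 2 + x 2 ^ 2 ≠ 0 := hx
  refine Fintype.linearIndependent_iff.2 fun c hc => ?_
  have hcoord : ∀ i, (∑ j, c j • coframe x j) i = 0 := fun i => by rw [hc, 𝔥.zero_apply]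
  have h0 : c 0 = 0 := by simpa [Fin.sum_univ_three, coframe, X, sub_eq_add_neg] using hcoord 0
  have h1 : c 1 * x 1 + c 2 * x 2 = 0 := by
    simpa [Fin.sum_univ_three, coframe, X, sub_eq_add_neg] using hcoord 1
  have h2 : -(c 1 * x 2) + c 2 * x 1 = 0 := by
    simpa [Fin.sum_univ_three, coframe, X, sub_eq_add_neg] using hcoord 2
  intro i
  fin_cases i
  · exact h0
  · exact (mul_eq_zero.1 (by linear_combination x 1 * h1 - x 2 * h2 :
      c 1 * (x 1 ^ 2 + x 2 ^ 2) = 0)).resolve_right hx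
  · exact (mul_eq_zero.1 (by linear_combination x 2 * h1 + x 1 * h2 :
      c 2 * (x 1 ^ 2 + x 2 ^ 2) = 0)).resolve_right hx

theorem finrank_𝔥 : Module.finrank ℝ 𝔥 = 3 := Module.finrank_fin_fun ℝ

/-- The coframe at a point of `Ω`, as a basis of the cotangent space. -/
noncomputable def coframeBasis (x : Ω) : Module.Basis (Fin 3) ℝ 𝔥 :=
  basisOfLinearIndependentOfCardEqFinrank (linearIndependent_coframe x.2) finrank_𝔥.symm

@[simp] theorem coframeBasis_apply (x : Ω) (i : Fin 3) : coframeBasis x i = coframe x i :=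
  congrFun (coe_basisOfLinearIndependentOfCardEqFinrank _ _) i

/-! ### Tangential multivector fields -/

theorem eq_zero_of_mem_Vtan {k : ℕ} {Q : V k} (hQ : Q ∈ Vtan k)
    (h : ∀ (x : Ω) (v : Fin k → Fin 2), v.Injective →
      Q.val x (fun i => coframe x (v i).castSucc) = 0) : Q = 0 := by
  refine V.ext_val fun x => ContinuousAlternatingMap.toAlternatingMap_injective <|
    (coframeBasis x).ext_alternating fun v hv => ?_
  simp only [coframeBasis_apply]
  by_cases hlast : ∃ i, v i = Fin.last 2
  · obtain ⟨i, hi⟩ := hlast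
    exact hQ x _ ⟨i, by rw [hi]; exact sharp_beta x⟩
  · choose w hw using fun i => Fin.exists_castSucc_eq.2 (not_exists.1 hlast i)
    obtain rfl : v = fun i => (w i).castSucc := funext fun i => (hw i).symm
    exact h x w fun i j hij => hv (congrArg Fin.castSucc hij)

theorem Vtan_eq_bot {k : ℕ} (hk : 2 < k) : Vtan k = ⊥ :=
  (Submodule.eq_bot_iff _).2 fun _ hQ => eq_zero_of_mem_Vtan hQ fun _ v hv =>
    absurd (Fintype.card_le_of_injective v hv) (by simpa using hk)

theorem eq_zero_of_mem_Vtan_two {Q : V 2} (hQ : Q ∈ Vtan 2)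
    (h : ∀ x : Ω, Q.val x ![coframe x 0, coframe x 1] = 0) : Q = 0 := by
  refine eq_zero_of_mem_Vtan hQ fun x v hv => ?_
  have hperm := (Q.val x).toAlternatingMap.map_perm ![coframe x 0, coframe x 1]
    (Equiv.ofBijective v (Finite.injective_iff_bijective.1 hv))
  have hcomp : ![coframe x 0, coframe x 1] ∘ v = fun i => coframe x (v i).castSucc := by
    funext i
    generalize hj : v i = j
    fin_cases j <;> simp [hj]
  have hx : (Q.val x).toAlternatingMap ![coframe x 0, coframe x 1] = 0 := h x
  rw [hx, smul_zero] at hperm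
  exact hcomp ▸ hperm

theorem Vtan_zero : Vtan 0 = ⊤ := top_unique fun _ _ _ _ ⟨i, _⟩ => i.elim0

/-! ### Contraction with `β` -/

theorem vecCons_swap {R M N : Type*} [Ring R] [AddCommGroup M] [Module R M] [TopologicalSpace M]
    [AddCommGroup N] [Module R N] [TopologicalSpace N] {k : ℕ} (f : M [⋀^Fin (k + 2)]→L[R] N)
    (ξ η : M) (v : Fin k → M) :
    f (Matrix.vecCons ξ (Matrix.vecCons η v)) = -f (Matrix.vecCons η (Matrix.vecCons ξ v)) := by
  have hcomp : Matrix.vecCons ξ (Matrix.vecCons η v) =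
      Matrix.vecCons η (Matrix.vecCons ξ v) ∘ Equiv.swap 0 1 := by
    funext i
    refine Fin.cases (by simp) (fun j => Fin.cases (by simp) (fun l => ?_) j) i
    have hfix : Equiv.swap (0 : Fin (k + 2)) 1 l.succ.succ = l.succ.succ :=
      Equiv.swap_apply_of_ne_of_ne (by simp) (by simp [Fin.ext_iff])
    simp [hfix]
  rw [hcomp]
  exact f.toAlternatingMap.map_swap _ (by simp)

theorem removeNth_succ_vecCons {α : Type*} {k : ℕ} (a : α) (v : Fin (k + 1) → α)
    (i : Fin (k + 1)) :
    i.succ.removeNth (Matrix.vecCons a v) = Matrix.vecCons a (i.removeNth v) :=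
  Fin.cons_comp_succ_succAbove a v i

theorem sum_sum_Ici_succ {M : Type*} [AddCommMonoid M] {n : ℕ} (f : Fin (n + 2) → Fin (n + 2) → M) :
    ∑ i, ∑ j ≥ i, f i j =
      ∑ j, f 0 j + ∑ i : Fin (n + 1), ∑ j ≥ i, f i.succ j.succ := by
  have hzero : Finset.Ici (0 : Fin (n + 2)) = Finset.univ := Finset.Ici_bot
  rw [Fin.sum_univ_succ, hzero]
  simp only [← Fin.map_succEmb_Ici, Finset.sum_map, Fin.coe_succEmb]

section Derivatives

variable {W W' : Type*} [NormedAddCommGroup W] [NormedSpace ℝ W] [NormedAddCommGroup W']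
  [NormedSpace ℝ W'] {L : Ω → W →L[ℝ] W'} {Q : Ω → W}

theorem Smooth.clm_apply (hL : Smooth L) (hQ : Smooth Q) : Smooth fun x => L x (Q x) :=
  Smooth.congr (ContDiffOn.clm_apply hL hQ) fun x => by simp

theorem D_clm_apply (hL : Smooth L) (hQ : Smooth Q) (x : Ω) (w : Dual) :
    D (fun y => L y (Q y)) x w = L x (D Q x w) + D L x w (Q x) := by
  rw [D_eq (F := fun y => ext0 L y (ext0 Q y)) (fun y => by simp),
    fderiv_clm_apply (hL.diffAt x) (hQ.diffAt x)]
  simp [D]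

end Derivatives

theorem smooth_beta : Smooth fun x : Ω => beta x :=
  Smooth.congr betaCLM.contDiff.contDiffOn fun _ => rfl

theorem D_beta (x : Ω) (w : Dual) : D (fun y : Ω => beta y) x w = beta w := by
  have hD : D (fun y : Ω => beta y) x = fderiv ℝ betaCLM x :=
    D_eq (Q := fun y : Ω => beta y) (F := betaCLM) (fun _ => rfl) x
  rw [hD, betaCLM.fderiv]
  rfl

/-- Insertion of a covector in the first argument of a multivector, as a continuous linear map. -/
noncomputable def curryCLM (k : ℕ) : Fiber (k + 1) →L[ℝ] 𝔥 →L[ℝ] Fiber k :=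
  ContinuousAlternatingMap.curryLeftLI.toContinuousLinearMap

@[simp] theorem curryCLM_apply {k : ℕ} (f : Fiber (k + 1)) (ξ : 𝔥) (v : Fin k → 𝔥) :
    curryCLM k f ξ v = f (Matrix.vecCons ξ v) := rfl

/-- The contraction `i_β` of multivector fields with the one-form `β`, inserted first. -/
noncomputable def contr (k : ℕ) : V (k + 1) →ₗ[Cas] V k where
  toFun Q := ⟨fun x => curryCLM k (Q.val x) (beta x),
    (Q.smooth.clm (curryCLM k)).clm_apply smooth_beta⟩
  map_add' P Q := V.ext_val fun x => by simp
  map_smul' f Q := V.ext_val fun x => by simp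

theorem contr_val_apply {k : ℕ} (Q : V (k + 1)) (x : Ω) (v : Fin k → 𝔥) :
    (contr k Q).val x v = Q.val x (Matrix.vecCons (beta x) v) := rfl

theorem contr_contr {k : ℕ} (Q : V (k + 2)) : contr k (contr (k + 1) Q) = 0 :=
  V.ext_val fun x => ContinuousAlternatingMap.ext fun _ =>
    (Q.val x).map_eq_zero_of_eq _ (i := 0) (j := 1) rfl (by simp)

theorem Vtan_succ_eq_ker_contr (k : ℕ) : Vtan (k + 1) = LinearMap.ker (contr k) := by
  ext Q
  refine ⟨fun h => V.ext_val fun x => ContinuousAlternatingMap.ext fun v =>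
    h x _ ⟨0, sharp_beta x⟩, fun h x v ⟨i, hi⟩ => ?_⟩
  have hhead : ∀ w : Fin (k + 1) → 𝔥, sharp x (w 0) = 0 → Q.val x w = 0 := fun w hw => by
    obtain ⟨c, hc⟩ : ∃ c : ℝ, c • beta x = w 0 :=
      Submodule.mem_span_singleton.1 (ker_sharp x.2 ▸ hw)
    rw [← Matrix.cons_head_tail w, Matrix.vecHead, ← hc, ContinuousAlternatingMap.vecCons_smul,
      ← contr_val_apply, h, V.zero_val, ContinuousAlternatingMap.coe_zero, Pi.zero_apply, smul_zero]
  obtain rfl | h0 := eq_or_ne i 0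
  · exact hhead v hi
  · have hswap := hhead (v ∘ Equiv.swap 0 i) (by simpa using hi)
    exact neg_eq_zero.1 (((Q.val x).toAlternatingMap.map_swap v h0.symm).symm.trans hswap)

theorem mem_Vtan_succ {k : ℕ} {Q : V (k + 1)} : Q ∈ Vtan (k + 1) ↔ contr k Q = 0 := by
  rw [Vtan_succ_eq_ker_contr, LinearMap.mem_ker]

/-- The correction term comes from the invariance of `β` in the form `∇_{ξ^#} β = -[ξ, β]`. -/
theorem D_contr_apply {k : ℕ} (Q : V (k + 1)) (x : Ω) (ξ : 𝔥) (v : Fin k → 𝔥) :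
    D (contr k Q).val x (sharp x ξ) v =
      D Q.val x (sharp x ξ) (Matrix.vecCons (beta x) v) -
        Q.val x (Matrix.vecCons ⁅ξ, beta x⁆ v) := by
  have hD : D (contr k Q).val x (sharp x ξ) = curryCLM k (Q.val x) (D (fun y => beta y) x _) +
      D (fun y => curryCLM k (Q.val y)) x (sharp x ξ) (beta x) :=
    D_clm_apply (Q.smooth.clm (curryCLM k)) smooth_beta x (sharp x ξ)
  rw [hD, D_beta, D_clm Q.smooth, beta_sharp, map_neg, neg_add_eq_sub]
  rfl

theorem contr_sigma_zero (f : V 0) : contr 0 (sigma 0 f) = 0 :=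
  V.ext_val fun x => ContinuousAlternatingMap.ext fun v => by
    rw [contr_val_apply, sigma_val, sigmaAt_zero, Matrix.cons_val_zero, sharp_beta, map_zero]
    rfl

/-- The left-hand side collects the terms of `(i_β σ Q)(v₀, …, v_k)` that contain a derivative of
`Q` or a bracket `[β, v_j]`. -/
theorem sum_D_contr {k : ℕ} (Q : V (k + 1)) (x : Ω) (v : Fin (k + 1) → 𝔥) :
    ∑ i : Fin (k + 2), (-1 : ℝ) ^ (i : ℕ) * D Q.val x (sharp x (Matrix.vecCons (beta x) v i))
        (i.removeNth (Matrix.vecCons (beta x) v)) -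
      ∑ j : Fin (k + 1), (-1 : ℝ) ^ (j : ℕ) *
        Q.val x (Matrix.vecCons ⁅beta x.1, v j⁆ (j.removeNth v)) =
    -∑ i : Fin (k + 1), (-1 : ℝ) ^ (i : ℕ) *
      D (contr k Q).val x (sharp x (v i)) (i.removeNth v) := by
  rw [Fin.sum_univ_succ, Matrix.cons_val_zero, sharp_beta, map_zero,
    ContinuousAlternatingMap.coe_zero, Pi.zero_apply, mul_zero, zero_add, ← Finset.sum_sub_distrib,
    ← Finset.sum_neg_distrib]
  refine Finset.sum_congr rfl fun i _ => ?_
  have hskew : Q.val x (Matrix.vecCons ⁅v i, beta x⁆ (i.removeNth v)) =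
      -Q.val x (Matrix.vecCons ⁅beta x.1, v i⁆ (i.removeNth v)) := by
    rw [← lie_skew, ← neg_one_smul ℝ, ContinuousAlternatingMap.vecCons_smul, neg_one_smul]
  rw [D_contr_apply, hskew, Matrix.cons_val_succ, removeNth_succ_vecCons, Fin.val_succ]
  ring

theorem contr_sigma {k : ℕ} (Q : V (k + 1)) :
    contr (k + 1) (sigma (k + 1) Q) = -sigma k (contr k Q) := by
  refine V.ext_val fun x => ContinuousAlternatingMap.ext fun v => ?_
  rw [V.neg_val, ContinuousAlternatingMap.neg_apply, contr_val_apply, sigma_val, sigma_val,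
    sigmaAt_succ]
  cases k with
  | zero =>
    have h := sum_D_contr Q x v
    rw [sigmaAt_zero]
    have hIci : Finset.Ici (0 : Fin 1) = {0} := rfl
    simpa [hIci, Subsingleton.elim (Fin.tail v) ![]] using h
  | succ k =>
    have hbracket : ∀ i j : Fin (k + 1), (-1 : ℝ) ^ (i.succ + j.succ : ℕ) *
        Q.val x (Matrix.vecCons ⁅Matrix.vecCons (beta x) v i.succ.castSucc,
          Matrix.vecCons (beta x) v j.succ.succ⁆
          (j.succ.removeNth (i.succ.castSucc.removeNth (Matrix.vecCons (beta x) v)))) =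
        -((-1 : ℝ) ^ (i + j : ℕ) * (contr (k + 1) Q).val x (Matrix.vecCons
          ⁅v i.castSucc, v j.succ⁆ (j.removeNth (i.castSucc.removeNth v)))) := fun i j => by
      rw [Fin.castSucc_succ, removeNth_succ_vecCons, removeNth_succ_vecCons, contr_val_apply,
        vecCons_swap, Matrix.cons_val_succ, Matrix.cons_val_succ, Fin.val_succ, Fin.val_succ]
      ring
    have h0 : (0 : Fin (k + 3)).removeNth (Matrix.vecCons (beta x.1) v) = v := rfl
    have h := sum_D_contr Q x v
    rw [sigmaAt_succ, sum_sum_Ici_succ]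
    simp only [hbracket, Finset.sum_neg_distrib]
    simp only [Fin.castSucc_zero, Matrix.cons_val_zero, Matrix.cons_val_succ, h0, Fin.val_zero,
      zero_add]
    linear_combination h

/-! ### The exact sequence relating `H` and `Htan` -/

/-- The wedge product of a vector and a `k`-vector, as a continuous bilinear map. -/
noncomputable def wedgeCLM (k : ℕ) : Fiber 1 →L[ℝ] Fiber k →L[ℝ] Fiber (k + 1) :=
  ContinuousLinearMap.compL ℝ (Fiber k) (𝔥 →L[ℝ] Fiber k) (Fiber (k + 1))
      (ContinuousAlternatingMap.alternatizeUncurryFinCLM ℝ 𝔥 ℝ) ∘L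
    ContinuousLinearMap.smulRightL ℝ 𝔥 (Fiber k) ∘L
    ContinuousLinearMap.compL ℝ 𝔥 (Fiber 0) ℝ (ContinuousAlternatingMap.apply ℝ 𝔥 ℝ ![]) ∘L
    curryCLM 0

theorem wedgeCLM_apply {k : ℕ} (p : Fiber 1) (q : Fiber k) (v : Fin (k + 1) → 𝔥) :
    wedgeCLM k p q v = ∑ i : Fin (k + 1), (-1 : ℝ) ^ (i : ℕ) * (p ![v i] * q (i.removeNth v)) :=
  (ContinuousAlternatingMap.alternatizeUncurryFin_apply
    ((ContinuousAlternatingMap.apply ℝ 𝔥 ℝ ![] ∘L curryCLM 0 p).smulRight q) v).trans (by simp)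

/-- The wedge product of a vector field and a `k`-vector field. -/
noncomputable def wedge {k : ℕ} (P : V 1) (Q : V k) : V (k + 1) :=
  ⟨fun x => wedgeCLM k (P.val x) (Q.val x), (P.smooth.clm (wedgeCLM k)).clm_apply Q.smooth⟩

theorem contr_wedge {k : ℕ} (P : V 1) {Q : V k} (hQ : Q ∈ Vtan k) (x : Ω) :
    (contr k (wedge P Q)).val x = P.val x ![beta x] • Q.val x := by
  ext v
  have htail : ∀ i : Fin k, Q.val x (i.succ.removeNth (Matrix.vecCons (beta x) v)) = 0 := by
    cases k with
    | zero => exact fun i => i.elim0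
    | succ k => exact fun i => hQ x _ ⟨0, sharp_beta x⟩
  rw [contr_val_apply]
  refine (wedgeCLM_apply _ _ _).trans ?_
  rw [Fin.sum_univ_succ]
  simp only [htail, mul_zero, Finset.sum_const_zero, add_zero, Fin.val_zero, pow_zero, one_mul]
  rfl

theorem transv_beta (x : Ω) : transv.val x ![beta x] = 1 := by
  have hx : x.1 1 ^ 2 + x.1 2 ^ 2 ≠ 0 := x.2
  change (x.1 1 ^ 2 + x.1 2 ^ 2)⁻¹ * (x.1 1 * beta x.1 2 + x.1 2 * beta x.1 1) = 1
  rw [beta_apply_one, beta_apply_two]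
  field_simp

theorem contr_mem_Vtan {k : ℕ} (Q : V (k + 1)) : contr k Q ∈ Vtan k := by
  cases k with
  | zero => exact Vtan_zero ▸ Submodule.mem_top
  | succ k => exact mem_Vtan_succ.2 (contr_contr Q)

theorem range_contr (k : ℕ) : LinearMap.range (contr k) = Vtan k :=
  le_antisymm (LinearMap.range_le_iff_comap.2 (eq_top_iff.2 fun Q _ => contr_mem_Vtan Q))
    fun Q hQ => ⟨wedge transv Q, V.ext_val fun x => by
      rw [contr_wedge transv hQ, transv_beta, one_smul]⟩

theorem sigma_mem_Vtan {k : ℕ} {Q : V k} (hQ : Q ∈ Vtan k) : sigma k Q ∈ Vtan (k + 1) := by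
  rw [mem_Vtan_succ]
  cases k with
  | zero => exact contr_sigma_zero Q
  | succ k => rw [contr_sigma, mem_Vtan_succ.1 hQ, map_zero, neg_zero]

theorem V.smooth_apply_pair (Q : V 2) {ξ η : Ω → 𝔥} (hξ : Smooth ξ) (hη : Smooth η) :
    Smooth fun x => Q.val x ![ξ x, η x] :=
  (((Q.smooth.clm (curryCLM 1)).clm_apply hξ).clm (curryCLM 0)).clm_apply hη |>.clm
    (ContinuousAlternatingMap.apply ℝ 𝔥 ℝ ![])

/-- The tangential vector field `a ∂₁`. -/
noncomputable def smulDelZero {a : Ω → ℝ} (ha : Smooth a) : V 1 :=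
  ⟨a • fun _ => del 0, ha.smul (Smooth.const (del 0))⟩

theorem smulDelZero_val {a : Ω → ℝ} (ha : Smooth a) (x : Ω) (ξ : 𝔥) :
    (smulDelZero ha).val x ![ξ] = a x * ξ 0 := rfl

theorem smulDelZero_mem_Vtan {a : Ω → ℝ} (ha : Smooth a) : smulDelZero ha ∈ Vtan 1 :=
  mem_Vtan_succ.2 <| V.ext_val fun x => ContinuousAlternatingMap.ext fun _ =>
    mul_eq_zero_of_right (a x) (beta_apply_zero x.1)

theorem sigma_one_apply (Q : V 1) (x : Ω) (ξ η : 𝔥) :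
    (sigma 1 Q).val x ![ξ, η] = D Q.val x (sharp x ξ) ![η] - D Q.val x (sharp x η) ![ξ] -
      Q.val x ![⁅ξ, η⁆] := by
  have hfst : (0 : Fin 2).removeNth ![ξ, η] = ![η] := rfl
  have hsnd : (1 : Fin 2).removeNth ![ξ, η] = ![ξ] := List.ofFn_inj.1 rfl
  rw [sigma_val, sigmaAt_succ, Fin.sum_univ_two]
  simp [hfst, hsnd, Matrix.empty_eq, sub_eq_add_neg]

theorem sigma_smulDelZero_apply {a : Ω → ℝ} (ha : Smooth a) (x : Ω) (ξ η : 𝔥) :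
    (sigma 1 (smulDelZero ha)).val x ![ξ, η] =
      D a x (sharp x ξ) * η 0 - D a x (sharp x η) * ξ 0 := by
  have hD : ∀ w ζ, D (smulDelZero ha).val x w ![ζ] = D a x w * ζ 0 := fun w ζ => by
    have hsmul : D (smulDelZero ha).val x =
        a x • D (fun _ => del 0) x + (D a x).smulRight (del 0) := D_smul ha (Smooth.const (del 0)) x
    rw [hsmul, D_const, smul_zero, zero_add]
    rfl
  rw [sigma_one_apply, hD, hD, smulDelZero_val, bracket_zero_apply, mul_zero, sub_zero]

theorem sigma_smulDelZero_coframe {a : Ω → ℝ} (ha : Smooth a) (x : Ω) :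
    (sigma 1 (smulDelZero ha)).val x ![coframe x 0, coframe x 1] =
      (x.1 1 ^ 2 + x.1 2 ^ 2) * D a x e₀ := by
  have h0 : coframe x 0 0 = 1 := rfl
  have h1 : coframe x 1 0 = 0 := by simp [coframe, X, sub_eq_add_neg]
  rw [sigma_smulDelZero_apply, sharp_coframe_one, map_smul, h0, h1, smul_eq_mul]
  ring

theorem smooth_coframe (i : Fin 3) : Smooth fun x : Ω => coframe x i := by
  refine Smooth.congr (F := fun x => coframe x i) (ContDiff.contDiffOn ?_) fun _ => rfl
  fin_cases i
  · exact contDiff_const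
  · exact (by fun_prop : ContDiff ℝ ∞ fun x : Dual => x 1 • X 1 - x 2 • X 2)
  · exact betaCLM.contDiff

theorem smooth_inv_sq_add_sq : Smooth fun x : Ω => (x.1 1 ^ 2 + x.1 2 ^ 2)⁻¹ :=
  Smooth.congr (F := fun x => (x 1 ^ 2 + x 2 ^ 2)⁻¹) (.inv (by fun_prop) fun _ hx => hx)
    fun _ => rfl

theorem Vtan_add_two_le (k : ℕ) : Vtan (k + 2) ≤ coboundariesTan (k + 2) := by
  cases k with
  | succ k => exact (Vtan_eq_bot (by omega)).trans_le bot_le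
  | zero =>
    intro W hW
    have hsmooth : Smooth fun x : Ω =>
        (x.1 1 ^ 2 + x.1 2 ^ 2)⁻¹ * W.val x ![coframe x 0, coframe x 1] :=
      smooth_inv_sq_add_sq.smul (W.smooth_apply_pair (smooth_coframe 0) (smooth_coframe 1))
    obtain ⟨a, ha, hDa⟩ := exists_smooth_primitive hsmooth
    refine ⟨smulDelZero ha, smulDelZero_mem_Vtan ha, ?_⟩
    refine sub_eq_zero.1 (eq_zero_of_mem_Vtan_two
      (sub_mem (sigma_mem_Vtan (smulDelZero_mem_Vtan ha)) hW) fun x => ?_)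
    rw [sub_eq_add_neg, V.add_val, V.neg_val, ContinuousAlternatingMap.add_apply,
      ContinuousAlternatingMap.neg_apply, sigma_smulDelZero_coframe, hDa, mul_inv_cancel_left₀ x.2,
      add_neg_cancel]

theorem mem_cocycles {k : ℕ} {Q : V k} : Q ∈ cocycles k ↔ sigma k Q = 0 := Iff.rfl

theorem H.mk_surjective {k : ℕ} : Function.Surjective (H.mk (k := k)) :=
  Submodule.Quotient.mk_surjective _

theorem H.mk_eq_zero {k : ℕ} {Q : cocycles k} : H.mk Q = 0 ↔ Q.1 ∈ coboundaries k :=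
  Submodule.Quotient.mk_eq_zero _

theorem Htan.mk_surjective {k : ℕ} : Function.Surjective (Htan.mk (k := k)) :=
  Submodule.Quotient.mk_surjective _

theorem Htan.mk_eq_zero {k : ℕ} {Q : cocyclesTan k} : Htan.mk Q = 0 ↔ Q.1 ∈ coboundariesTan k :=
  Submodule.Quotient.mk_eq_zero _

theorem subsingleton_Htan {k : ℕ} (hk : 1 < k) : Subsingleton (Htan k) := by
  obtain ⟨k, rfl⟩ := Nat.exists_eq_add_of_le' hk
  exact Submodule.Quotient.subsingleton_iff.2 (Submodule.submoduleOf_eq_top.2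
    (inf_le_right.trans (Vtan_add_two_le k)))

theorem contr_mem_cocyclesTan {k : ℕ} {Q : V (k + 1)} (hQ : Q ∈ cocycles (k + 1)) :
    contr k Q ∈ cocyclesTan k :=
  ⟨mem_cocycles.2 (by rw [← neg_eq_zero, ← contr_sigma, mem_cocycles.1 hQ, map_zero]),
    contr_mem_Vtan Q⟩

theorem contr_mem_coboundariesTan {k : ℕ} {Q : V (k + 1)} (hQ : Q ∈ coboundaries (k + 1)) :
    contr k Q ∈ coboundariesTan k := by
  obtain ⟨P, rfl⟩ := hQ
  cases k with
  | zero => exact (Submodule.mem_bot Cas).2 (contr_sigma_zero P)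
  | succ k => exact ⟨-contr k P, neg_mem (contr_mem_Vtan P), by rw [map_neg, contr_sigma]⟩

theorem coboundariesTan_le (k : ℕ) : coboundariesTan k ≤ coboundaries k := by
  cases k with
  | zero => exact le_rfl
  | succ k => exact LinearMap.map_le_range

/-- The map from tangential Poisson cohomology to Poisson cohomology. -/
noncomputable def tanToH (k : ℕ) : Htan k →ₗ[Cas] H k :=
  Submodule.mapQ _ _ (tanIncl k) fun Q hQ => coboundariesTan_le k (x := Q.1) hQ

theorem tanToH_mk {k : ℕ} (A : cocyclesTan k) : tanToH k (Htan.mk A) = H.mk (tanIncl k A) := rfl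

/-- The map induced in cohomology by the contraction with `β`. -/
noncomputable def contrH (k : ℕ) : H (k + 1) →ₗ[Cas] Htan k :=
  Submodule.mapQ _ _ ((contr k).restrict fun _ => contr_mem_cocyclesTan)
    fun Q hQ => contr_mem_coboundariesTan (Q := Q.1) hQ

theorem contrH_mk {k : ℕ} (Q : cocycles (k + 1)) :
    contrH k (H.mk Q) = Htan.mk ⟨contr k Q.1, contr_mem_cocyclesTan Q.2⟩ := rfl

theorem tanToH_one_injective : Function.Injective (tanToH 1) := by
  refine (injective_iff_map_eq_zero _).2 fun a ha => ?_
  obtain ⟨A, rfl⟩ := Htan.mk_surjective a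
  obtain ⟨f, hf⟩ := H.mk_eq_zero.1 ha
  exact Htan.mk_eq_zero.2 ⟨f, Vtan_zero ▸ Submodule.mem_top, hf⟩

theorem exact_tanToH_contrH : Function.Exact (tanToH 1) (contrH 0) := by
  intro q
  obtain ⟨Q, rfl⟩ := H.mk_surjective q
  rw [contrH_mk, Htan.mk_eq_zero]
  refine ⟨fun h => ⟨Htan.mk ⟨Q.1, Q.2, mem_Vtan_succ.2 h⟩, rfl⟩, ?_⟩
  rintro ⟨a, ha⟩
  obtain ⟨A, rfl⟩ := Htan.mk_surjective a
  exact Htan.mk_eq_zero.1 <| (contrH_mk Q).symm.trans <| ha ▸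
    Htan.mk_eq_zero.2 (mem_Vtan_succ.1 A.2.2)

theorem contrH_surjective (k : ℕ) : Function.Surjective (contrH k) := by
  intro a
  obtain ⟨A, rfl⟩ := Htan.mk_surjective a
  obtain ⟨W, hW⟩ : A.1 ∈ LinearMap.range (contr k) := range_contr k ▸ A.2.2
  have hσW : sigma (k + 1) W ∈ Vtan (k + 2) := by
    rw [mem_Vtan_succ, contr_sigma, hW, mem_cocycles.1 A.2.1, neg_zero]
  obtain ⟨B, hB, hσB⟩ := Vtan_add_two_le k hσW
  have hcocycle : W - B ∈ cocycles (k + 1) := by rw [mem_cocycles, map_sub, hσB, sub_self]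
  have hcontr : contr k (W - B) = A.1 := by rw [map_sub, hW, mem_Vtan_succ.1 hB, sub_zero]
  exact ⟨H.mk ⟨W - B, hcocycle⟩, congrArg Htan.mk (Subtype.ext hcontr)⟩

theorem contrH_succ_injective (k : ℕ) : Function.Injective (contrH (k + 1)) := by
  refine (injective_iff_map_eq_zero _).2 fun q hq => ?_
  obtain ⟨Q, rfl⟩ := H.mk_surjective q
  rw [contrH_mk, Htan.mk_eq_zero] at hq
  obtain ⟨B, hB, hσB⟩ := hq
  obtain ⟨W, rfl⟩ : B ∈ LinearMap.range (contr k) := range_contr k ▸ hB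
  have hQW : Q.1 + sigma (k + 1) W ∈ Vtan (k + 2) := by
    rw [mem_Vtan_succ, map_add, contr_sigma, hσB, add_neg_cancel]
  obtain ⟨P, -, hP⟩ := Vtan_add_two_le k hQW
  exact H.mk_eq_zero.2 ⟨P - W, by rw [map_sub, hP, add_sub_cancel_right]⟩

/-- In degrees at least two, `H^k` is `Htan^(k-1)`. -/
noncomputable def contrHEquiv (k : ℕ) : H (k + 2) ≃ₗ[Cas] Htan (k + 1) :=
  .ofBijective (contrH (k + 1)) ⟨contrH_succ_injective k, contrH_surjective (k + 1)⟩

theorem subsingleton_H {k : ℕ} (hk : 2 < k) : Subsingleton (H k) := by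
  obtain ⟨k, rfl⟩ := Nat.exists_eq_add_of_le' hk
  have := subsingleton_Htan (k := k + 2) (by omega)
  exact (contrHEquiv (k + 1)).toEquiv.subsingleton

/-! ### Degrees zero and one -/

theorem submoduleOf_bot {R M : Type*} [Semiring R] [AddCommMonoid M] [Module R M]
    (N : Submodule R M) : (⊥ : Submodule R M).submoduleOf N = ⊥ :=
  (Submodule.comap_bot _).trans N.ker_subtype

/-- A smooth function as a section of `⋀⁰`. -/
noncomputable def fn {f : Ω → ℝ} (hf : Smooth f) : V 0 :=
  ⟨f • fun _ => ContinuousAlternatingMap.constOfIsEmpty ℝ 𝔥 (Fin 0) 1, hf.smul (Smooth.const _)⟩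

theorem fn_val {f : Ω → ℝ} (hf : Smooth f) (x : Ω) (v : Fin 0 → 𝔥) : (fn hf).val x v = f x :=
  mul_one (f x)

theorem smooth_eval {k : ℕ} (Q : V k) (v : Fin k → 𝔥) : Smooth fun x => Q.val x v :=
  Q.smooth.clm (ContinuousAlternatingMap.apply ℝ 𝔥 ℝ v)

theorem sigma_zero_apply (f : V 0) (x : Ω) (v : Fin 1 → 𝔥) :
    (sigma 0 f).val x v = D (fun x => f.val x ![]) x (sharp x (v 0)) := by
  have hclm : D (fun x => f.val x ![]) x = _ ∘L D f.val x :=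
    D_clm f.smooth (ContinuousAlternatingMap.apply ℝ 𝔥 ℝ ![]) x
  rw [hclm]
  exact sigmaAt_zero f.val x v

theorem mem_cocycles_zero {f : V 0} :
    f ∈ cocycles 0 ↔ ∀ (x : Ω) (ξ : 𝔥), D (fun x => f.val x ![]) x (sharp x ξ) = 0 := by
  refine ⟨fun h x ξ => ?_, fun h => V.ext_val fun x => ContinuousAlternatingMap.ext fun v => ?_⟩
  · refine (sigma_zero_apply f x ![ξ]).symm.trans ?_
    rw [mem_cocycles.1 h]
    rfl
  · rw [sigma_zero_apply, h]
    rfl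

/-- Degree-zero cocycles are the Casimir functions. -/
noncomputable def cocyclesZeroEquiv : cocycles 0 ≃ₗ[Cas] Cas where
  toFun f := ⟨fun x => f.1.val x ![], smooth_eval f.1 ![], mem_cocycles_zero.1 f.2⟩
  map_add' _ _ := rfl
  map_smul' _ _ := rfl
  invFun f := ⟨fn f.smooth, mem_cocycles_zero.2 (by simpa only [fn_val] using f.casimir)⟩
  left_inv f := Subtype.ext <| V.ext_val fun x => ContinuousAlternatingMap.ext fun v => by
    rw [fn_val, Matrix.empty_eq v]
  right_inv f := Cas.ext <| funext fun x => fn_val f.smooth x ![]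

/-- `H⁰` is the ring of Casimir functions. -/
noncomputable def HZeroEquiv : H 0 ≃ₗ[Cas] Cas :=
  (Submodule.quotEquivOfEqBot _ (submoduleOf_bot _)).trans cocyclesZeroEquiv

/-- `Htan⁰` is the ring of Casimir functions. -/
noncomputable def HtanZeroEquiv : Htan 0 ≃ₗ[Cas] Cas :=
  (Submodule.quotEquivOfEqBot _ (submoduleOf_bot _)).trans <|
    (LinearEquiv.ofEq (cocyclesTan 0) (cocycles 0)
      (by rw [cocyclesTan, Vtan_zero, inf_top_eq])).trans cocyclesZeroEquiv

theorem toSpanSingleton_transv_injective :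
    Function.Injective (LinearMap.toSpanSingleton Cas (V 1) transv) := by
  refine (injective_iff_map_eq_zero _).2 fun f hf => Cas.ext <| funext fun x => ?_
  have hx : f.val x * transv.val x ![beta x] = 0 := congrArg (fun Q => Q.val x ![beta x]) hf
  rwa [transv_beta, mul_one] at hx

/-- The module spanned by `transv` is free on `transv`. -/
noncomputable def spanTransvEquiv : Cas ≃ₗ[Cas] Submodule.span Cas {transv} :=
  (LinearEquiv.ofInjective _ toSpanSingleton_transv_injective).trans
    (.ofEq _ _ (LinearMap.range_toSpanSingleton transv))

/-- The transverse part `[Q] ↦ β(Q) transv` of a class of degree one. -/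
noncomputable def transvPart : H 1 →ₗ[Cas] Submodule.span Cas {transv} :=
  (HtanZeroEquiv.trans spanTransvEquiv).toLinearMap ∘ₗ contrH 0

theorem transvPart_mk (Q : cocycles 1) (x : Ω) (ξ : 𝔥) :
    (transvPart (H.mk Q)).1.val x ![ξ] = Q.1.val x ![beta x] * transv.val x ![ξ] := rfl

theorem exact_tanToH_transvPart : Function.Exact (tanToH 1) transvPart :=
  exact_tanToH_contrH.comp_injective _ (HtanZeroEquiv.trans spanTransvEquiv).injective
    (map_zero _)

/-- The exact sequence `0 → Htan¹ → H¹ → Cas • transv → 0` splits, as its last term is free. -/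
theorem exists_H_one_equiv :
    ∃ e : H 1 ≃ₗ[Cas] Htan 1 × Submodule.span Cas {transv},
      (∀ A : cocyclesTan 1, e (H.mk (tanIncl 1 A)) = (Htan.mk A, 0)) ∧
      ∀ q, (e q).2 = transvPart q := by
  have : Module.Projective Cas (Submodule.span Cas {transv}) := .of_equiv spanTransvEquiv
  obtain ⟨s, hs⟩ := Module.projective_lifting_property transvPart LinearMap.id
    ((HtanZeroEquiv.trans spanTransvEquiv).surjective.comp (contrH_surjective 0))
  obtain ⟨e, hinl, hsnd⟩ :=
    exact_tanToH_transvPart.splitSurjectiveEquiv tanToH_one_injective ⟨s, hs⟩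
  refine ⟨e, fun A => ?_, fun q => (LinearMap.congr_fun hsnd q).symm⟩
  rw [← tanToH_mk, hinl]
  exact e.apply_symm_apply _

/-! ### Infinite dimensionality -/

section InfiniteDimension

open Filter Topology Asymptotics MeasureTheory

theorem exists_finset_sup_span_eq_top {R M : Type*} [Ring R] [AddCommGroup M] [Module R M]
    (N : Submodule R M) [Module.Finite R (M ⧸ N)] :
    ∃ S : Finset M, N ⊔ Submodule.span R S = ⊤ := by
  classical
  obtain ⟨S, hS⟩ := Module.Finite.fg_top (R := R) (M := M ⧸ N)
  choose r hr using N.mkQ_surjective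
  have hrS : N.mkQ '' (S.image r : Finset M) = S := by
    simp only [Finset.coe_image, Set.image_image, hr, Set.image_id']
  exact ⟨S.image r, by
    rw [← Submodule.comap_map_mkQ, Submodule.map_span, hrS, hS, Submodule.comap_top]⟩

theorem exists_contDiff_forall_le_of_mem_closedBall {E : Type*} [NormedAddCommGroup E]
    [NormedSpace ℝ E] [FiniteDimensional ℝ E] {G : E → ℝ} (hG : Continuous G) (r : ℝ) :
    ∃ K : E → ℝ, ContDiff ℝ ∞ K ∧ ∀ x, ∀ y ∈ Metric.closedBall x r, G y ≤ K x := by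
  have : ProperSpace E := FiniteDimensional.proper ℝ E
  obtain ⟨K, hK⟩ := exists_contMDiffMap_forall_mem_convex_of_local_const (n := (⊤ : ℕ∞))
    (modelWithCornersSelf ℝ E) (t := fun x => {c : ℝ | ∀ y ∈ Metric.closedBall x r, G y ≤ c})
    (fun x => by
      simp only [Set.ofPred_forall]
      exact convex_iInter₂ fun y _ => convex_Ici (G y))
    (fun x => by
      obtain ⟨c, hc⟩ := (isCompact_closedBall x (1 + r)).bddAbove_image hG.continuousOn
      refine ⟨c, ?_⟩
      filter_upwards [Metric.closedBall_mem_nhds x one_pos] with x' hx' y hy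
      refine hc ⟨y, Metric.mem_closedBall.2 ((dist_triangle y x' x).trans ?_), rfl⟩
      linarith [Metric.mem_closedBall.1 hx', Metric.mem_closedBall.1 hy])
  exact ⟨K, K.contMDiff.contDiff, hK⟩

theorem isInfDim_of_not_finite {M : Type} [AddCommGroup M] [Module Cas M]
    (h : ¬ Module.Finite Cas M) : IsInfDim M :=
  ⟨fun _ =>
      letI := RestrictScalars.moduleOrig ℝ Cas M
      h (Module.Finite.of_restrictScalars_finite ℝ Cas (RestrictScalars ℝ Cas M)),
    fun _ => h (Module.Finite.of_restrictScalars_finite polyInv Cas M),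
    fun _ => h (Module.Finite.of_restrictScalars_finite anaInv Cas M)⟩

/-- An integral curve of `H_{x₁}` in the leaf `x₂ x₃ = e^{-2s}`. It runs from `(0, e^{-2s}, 1)` at
`t = -s` to `(0, 1, e^{-2s})` at `t = s`, so both ends converge in `Ω` as `s → ∞`. -/
noncomputable def curve (s t : ℝ) : Ω :=
  ⟨pt 0 (Real.exp (t - s)) (Real.exp (-t - s)), pt_mem_Ω.2 (by positivity)⟩

theorem hasDerivAt_curve (s t : ℝ) :
    HasDerivAt (fun t => (curve s t : Dual)) (sharp (curve s t) (X 0)) t := by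
  rw [sharp_X_zero]
  refine hasDerivAt_pt (hasDerivAt_const t 0) ?_ ?_
  · simpa [curve, pt] using ((hasDerivAt_id t).sub_const s).exp
  · simpa [curve, pt] using ((hasDerivAt_id t).neg.sub_const s).exp

theorem continuous_curve : Continuous fun q : ℝ × ℝ => curve q.1 q.2 :=
  (contDiff_pt (n := 0) (by fun_prop) (by fun_prop) (by fun_prop)).continuous.subtype_mk _

theorem isBigO_comp_of_tendsto_pt {g : Ω → ℝ} (hg : Continuous g) {c : ℝ → Ω} {p y z : ℝ}
    (hyz : y ^ 2 + z ^ 2 ≠ 0) (hc : Tendsto (fun s => (c s : Dual)) atTop (𝓝 (pt p y z))) :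
    (fun s => g (c s)) =O[atTop] fun _ => (1 : ℝ) :=
  ((hg.tendsto ⟨pt p y z, pt_mem_Ω.2 hyz⟩).comp (tendsto_subtype_rng.2 hc)).isBigO_one ℝ

theorem tendsto_exp_neg_sub_self : Tendsto (fun s : ℝ => Real.exp (-s - s)) atTop (𝓝 0) :=
  Real.tendsto_exp_atBot.comp (tendsto_neg_atTop_atBot.atBot_add_atBot tendsto_neg_atTop_atBot)

theorem isBigO_comp_curve_left {g : Ω → ℝ} (hg : Continuous g) :
    (fun s => g (curve s (-s))) =O[atTop] fun _ => (1 : ℝ) := by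
  refine isBigO_comp_of_tendsto_pt hg (p := 0) (y := 0) (z := 1) (by norm_num)
    (tendsto_pi_nhds.2 fun i => ?_)
  fin_cases i
  · exact tendsto_const_nhds
  · exact tendsto_exp_neg_sub_self
  · simp [curve, pt]

theorem isBigO_comp_curve_right {g : Ω → ℝ} (hg : Continuous g) :
    (fun s => g (curve s s)) =O[atTop] fun _ => (1 : ℝ) := by
  refine isBigO_comp_of_tendsto_pt hg (p := 0) (y := 1) (z := 0) (by norm_num)
    (tendsto_pi_nhds.2 fun i => ?_)
  fin_cases i
  · exact tendsto_const_nhds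
  · simp [curve, pt]
  · exact tendsto_exp_neg_sub_self

/-- The integral of a function along `curve s`, between the two ends of that curve. -/
noncomputable def curveIntegral (f : Ω → ℝ) (s : ℝ) : ℝ := ∫ t in -s..s, f (curve s t)

theorem intervalIntegrable_comp_curve {f : Ω → ℝ} (hf : Continuous f) (s a b : ℝ) :
    IntervalIntegrable (fun t => f (curve s t)) volume a b :=
  ((hf.comp continuous_curve).comp (Continuous.prodMk_right s)).intervalIntegrable a b

theorem continuous_curveIntegral {f : Ω → ℝ} (hf : Continuous f) :
    Continuous (curveIntegral f) := by
  have hsub : curveIntegral f = fun s =>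
      (∫ t in (0 : ℝ)..s, f (curve s t)) - ∫ t in (0 : ℝ)..-s, f (curve s t) := funext fun s =>
    (intervalIntegral.integral_interval_sub_left (intervalIntegrable_comp_curve hf s _ _)
      (intervalIntegrable_comp_curve hf s _ _)).symm
  rw [hsub]
  exact (intervalIntegral.continuous_parametric_intervalIntegral_of_continuous
    (f := fun s t => f (curve s t)) (hf.comp continuous_curve) continuous_id).sub
    (intervalIntegral.continuous_parametric_intervalIntegral_of_continuous
      (f := fun s t => f (curve s t)) (hf.comp continuous_curve) continuous_neg)

theorem curveIntegral_add {f g : Ω → ℝ} (hf : Continuous f) (hg : Continuous g) (s : ℝ) :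
    curveIntegral (f + g) s = curveIntegral f s + curveIntegral g s :=
  intervalIntegral.integral_add (intervalIntegrable_comp_curve hf s _ _)
    (intervalIntegrable_comp_curve hg s _ _)

theorem Cas.val_curve (f : Cas) (s t : ℝ) : f.val (curve s t) = f.val (curve s s) := by
  have hderiv : ∀ t, HasDerivAt (fun t => f.val (curve s t)) 0 t := fun t =>
    (hasDerivAt_smooth_comp f.smooth (hasDerivAt_curve s t)).congr_deriv (f.casimir _ _)
  exact is_const_of_deriv_eq_zero (fun t => (hderiv t).differentiableAt)
    (fun t => (hderiv t).deriv) t s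

theorem curveIntegral_cas_mul (f : Cas) (g : Ω → ℝ) (s : ℝ) :
    curveIntegral (f.val * g) s = f.val (curve s s) * curveIntegral g s := by
  simp only [curveIntegral, Pi.mul_apply, f.val_curve, intervalIntegral.integral_const_mul]

theorem curveIntegral_sharp {g : Ω → ℝ} (hg : Smooth g)
    (hDg : Continuous fun x : Ω => D g x (sharp x (X 0))) (s : ℝ) :
    curveIntegral (fun x => D g x (sharp x (X 0))) s = g (curve s s) - g (curve s (-s)) :=
  intervalIntegral.integral_eq_sub_of_hasDerivAt
    (fun t _ => hasDerivAt_smooth_comp hg (hasDerivAt_curve s t))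
    (intervalIntegrable_comp_curve hDg s _ _)

theorem le_curveIntegral {f : Ω → ℝ} (hf : Continuous f) (hf₀ : 0 ≤ f) {c s : ℝ}
    (hs : 1 / 2 ≤ s) (hc : ∀ t, |t| ≤ 1 / 2 → c ≤ f (curve s t)) : c ≤ curveIntegral f s := by
  calc c = ∫ _ in (-(1 / 2) : ℝ)..(1 / 2), c := by
        rw [intervalIntegral.integral_const]; norm_num
    _ ≤ ∫ t in (-(1 / 2) : ℝ)..(1 / 2), f (curve s t) :=
      intervalIntegral.integral_mono_on (by norm_num) intervalIntegrable_const
        (intervalIntegrable_comp_curve hf s _ _) fun t ht => hc t (abs_le.2 ht)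
    _ ≤ curveIntegral f s :=
      intervalIntegral.integral_mono_interval (by linarith) (by norm_num) hs
        (.of_forall fun t => hf₀ _) (intervalIntegrable_comp_curve hf s _ _)

/-- The vector fields whose `∂₁`-component has integrals along the curves `curve s` that are
`O(B s)` as `s → ∞`. -/
noncomputable def boundedFields (B : ℝ → ℝ) : Submodule Cas (V 1) where
  carrier := {Q | curveIntegral (fun x => Q.val x ![X 0]) =O[atTop] B}
  add_mem' {P Q} hP hQ := (hP.add hQ).congr_left fun s =>
    (curveIntegral_add (smooth_eval P _).continuous (smooth_eval Q _).continuous s).symm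
  zero_mem' := (isBigO_zero B atTop).congr_left fun _ =>
    intervalIntegral.integral_zero.symm
  smul_mem' f Q hQ := by
    have h := (isBigO_comp_curve_right f.smooth.continuous).mul hQ
    simp only [one_mul] at h
    exact h.congr_left fun s => (curveIntegral_cas_mul f _ s).symm

theorem mem_boundedFields {B : ℝ → ℝ} {Q : V 1} :
    Q ∈ boundedFields B ↔ curveIntegral (fun x => Q.val x ![X 0]) =O[atTop] B := Iff.rfl

theorem coboundaries_le_boundedFields {B : ℝ → ℝ} (hB : (fun _ => (1 : ℝ)) =O[atTop] B) :
    coboundaries 1 ≤ boundedFields B := by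
  rintro _ ⟨g, rfl⟩
  have hg := smooth_eval g ![]
  have hσ : (fun x => (sigma 0 g).val x ![X 0]) =
      fun x : Ω => D (fun x => g.val x ![]) x (sharp x (X 0)) :=
    funext fun x => sigma_zero_apply g x _
  have hcont := (smooth_eval (sigma 0 g) ![X 0]).continuous
  rw [hσ] at hcont
  rw [mem_boundedFields, hσ, funext (curveIntegral_sharp hg hcont)]
  exact ((isBigO_comp_curve_right hg.continuous).sub
    (isBigO_comp_curve_left hg.continuous)).trans hB

theorem exists_cocyclesTan_le_boundedFields [Module.Finite Cas (Htan 1)] :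
    ∃ B : ℝ → ℝ, Continuous B ∧ (∀ s, 1 ≤ B s) ∧ cocyclesTan 1 ≤ boundedFields B := by
  obtain ⟨S, hS⟩ := exists_finset_sup_span_eq_top ((coboundariesTan 1).submoduleOf (cocyclesTan 1))
  let I : cocyclesTan 1 → ℝ → ℝ := fun A => curveIntegral fun x => A.1.val x ![X 0]
  have hI : ∀ s, 0 ≤ ∑ A ∈ S, |I A s| := fun s => Finset.sum_nonneg fun _ _ => abs_nonneg _
  let B : ℝ → ℝ := fun s => 1 + ∑ A ∈ S, |I A s|
  have hB : ∀ s, 1 ≤ B s := fun s => le_add_of_nonneg_right (hI s)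
  refine ⟨B, continuous_const.add (continuous_finsetSum _ fun A _ =>
    (continuous_curveIntegral (smooth_eval A.1 _).continuous).abs), hB, ?_⟩
  have hle : (coboundariesTan 1).submoduleOf (cocyclesTan 1) ⊔ Submodule.span Cas S ≤
      (boundedFields B).submoduleOf (cocyclesTan 1) := by
    refine sup_le (Submodule.comap_mono ((coboundariesTan_le 1).trans
      (coboundaries_le_boundedFields (.of_norm_le fun s => norm_one.trans_le (hB s)))))
      (Submodule.span_le.2 fun A hA => IsBigO.of_norm_le fun s => ?_)
    exact (Finset.single_le_sum (f := fun A => |I A s|) (fun _ _ => abs_nonneg _) hA).trans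
      (le_add_of_nonneg_left zero_le_one)
  exact Submodule.submoduleOf_eq_top.1 (top_unique (hS ▸ hle))

theorem smulDelZero_mem_cocyclesTan {a : Ω → ℝ} (ha : Smooth a) (h : ∀ x, D a x e₀ = 0) :
    smulDelZero ha ∈ cocyclesTan 1 :=
  ⟨mem_cocycles.2 <|
    eq_zero_of_mem_Vtan_two (sigma_mem_Vtan (smulDelZero_mem_Vtan ha)) fun x => by
      rw [sigma_smulDelZero_coframe, h, mul_zero], smulDelZero_mem_Vtan ha⟩

/-- The logarithm of `x₂² + x₃²`. -/
noncomputable def logNormSq (x : Ω) : ℝ := Real.log (x.1 1 ^ 2 + x.1 2 ^ 2)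

theorem smooth_comp_logNormSq {K : ℝ → ℝ} (hK : ContDiff ℝ ∞ K) :
    Smooth fun x => K (logNormSq x) :=
  Smooth.congr (F := fun x => K (Real.log (x 1 ^ 2 + x 2 ^ 2)))
    (hK.comp_contDiffOn (ContDiffOn.log (by fun_prop) fun _ hx => hx)) fun _ => rfl

theorem D_apply_e₀_eq_zero {W : Type*} [NormedAddCommGroup W] [NormedSpace ℝ W] {f : Ω → W}
    (hf : Smooth f) (h : ∀ x y : Ω, x.1 1 = y.1 1 → x.1 2 = y.1 2 → f x = f y) (x : Ω) :
    D f x e₀ = 0 := by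
  have hline : (fun s => f (axisLine x s)) = fun _ => f x := funext fun s => h _ _ rfl rfl
  have hderiv := hasDerivAt_smooth_comp hf (hasDerivAt_axisLine x (x.1 0))
  rw [axisLine_self, hline] at hderiv
  exact hderiv.unique (hasDerivAt_const _ _)

theorem abs_logNormSq_curve_add_le (s : ℝ) {t : ℝ} (ht : |t| ≤ 1 / 2) :
    |logNormSq (curve s t) + 2 * s| ≤ 2 := by
  have hlog : logNormSq (curve s t) + 2 * s = Real.log (Real.exp (2 * t) + Real.exp (-2 * t)) := by
    rw [← Real.log_exp (2 * s), logNormSq, ← Real.log_mul (curve s t).2 (Real.exp_ne_zero _)]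
    change Real.log ((Real.exp (t - s) ^ 2 + Real.exp (-t - s) ^ 2) * _) = _
    simp only [← Real.exp_nat_mul, add_mul, ← Real.exp_add]
    ring_nf
  obtain ⟨ht₁, ht₂⟩ := abs_le.1 ht
  have hlower : 1 ≤ Real.exp (2 * t) + Real.exp (-2 * t) := by
    linarith [Real.add_one_le_exp (2 * t), Real.add_one_le_exp (-2 * t)]
  have hupper : Real.exp (2 * t) + Real.exp (-2 * t) ≤ Real.exp 2 := by
    have hexp : Real.exp 2 = Real.exp 1 * Real.exp 1 := by rw [← Real.exp_add]; norm_num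
    have h₁ : Real.exp (2 * t) ≤ Real.exp 1 := Real.exp_le_exp.2 (by linarith)
    have h₂ : Real.exp (-2 * t) ≤ Real.exp 1 := Real.exp_le_exp.2 (by linarith)
    nlinarith [Real.add_one_le_exp 1]
  rw [hlog, abs_of_nonneg (Real.log_nonneg hlower)]
  exact (Real.log_le_iff_le_exp (by linarith)).2 hupper

theorem exists_cocyclesTan_notMem_boundedFields {B : ℝ → ℝ} (hB : Continuous B)
    (hB₁ : ∀ s, 1 ≤ B s) : ∃ A ∈ cocyclesTan 1, A ∉ boundedFields B := by
  obtain ⟨K, hK, hKB⟩ := exists_contDiff_forall_le_of_mem_closedBall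
    (G := fun r => |r| * B (-r / 2)) (by fun_prop) 2
  have hB₀ : ∀ s, 0 < B s := fun s => one_pos.trans_le (hB₁ s)
  have hf := smooth_comp_logNormSq hK
  refine ⟨smulDelZero hf, smulDelZero_mem_cocyclesTan hf
    (D_apply_e₀_eq_zero hf fun x y h₁ h₂ => by simp only [logNormSq, h₁, h₂]), fun hmem => ?_⟩
  have hval : (fun x => (smulDelZero hf).val x ![X 0]) = fun x => K (logNormSq x) :=
    funext fun x => by rw [smulDelZero_val, X, if_pos rfl, mul_one]
  have hgrowth : ∀ s, 1 / 2 ≤ s → 2 * s * B s ≤ curveIntegral (fun x => K (logNormSq x)) s := by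
    intro s hs
    refine le_curveIntegral hf.continuous (fun x => ?_) hs fun t ht => ?_
    · exact (mul_nonneg (abs_nonneg _) (hB₀ _).le).trans
        (hKB _ _ (Metric.mem_closedBall_self two_pos.le))
    · refine le_of_eq_of_le ?_ (hKB _ (-2 * s) ?_)
      · rw [abs_mul, abs_neg, abs_two, abs_of_nonneg (by linarith : 0 ≤ s)]
        ring_nf
      · rw [Metric.mem_closedBall, dist_comm, Real.dist_eq]
        simpa using abs_logNormSq_curve_add_le s ht
  rw [mem_boundedFields, hval] at hmem
  obtain ⟨C, hC⟩ := hmem.bound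
  obtain ⟨s, hCs, hs, hsC⟩ :=
    (hC.and ((eventually_ge_atTop (1 / 2)).and (eventually_gt_atTop (C / 2)))).exists
  rw [Real.norm_eq_abs, Real.norm_eq_abs, abs_of_pos (hB₀ s)] at hCs
  nlinarith [hgrowth s hs, le_abs_self (curveIntegral (fun x => K (logNormSq x)) s), hB₀ s]

theorem not_finite_Htan_one : ¬ Module.Finite Cas (Htan 1) := fun _ =>
  have ⟨_, hB, hB₁, hle⟩ := exists_cocyclesTan_le_boundedFields
  have ⟨_, hA, hAB⟩ := exists_cocyclesTan_notMem_boundedFields hB hB₁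
  hAB (hle hA)

theorem isInfDim_of_surjective_Htan_one {M : Type} [AddCommGroup M] [Module Cas M]
    {p : M →ₗ[Cas] Htan 1} (hp : Function.Surjective p) : IsInfDim M :=
  isInfDim_of_not_finite fun _ => not_finite_Htan_one (Module.Finite.of_surjective p hp)

end InfiniteDimension

/-! ### Coadjoint orbits -/

theorem coad_apply (ξ : 𝔥) (x : Dual) : coad ξ x = -sharp x ξ := rfl

theorem coad_neg (ξ : 𝔥) : coad (-ξ) = -coad ξ := by
  ext1 x
  rw [coad_apply, map_neg, neg_apply, coad_apply]

theorem coad_apply_of_notMem {x : Dual} (hx : x ∉ Ω) (ξ : 𝔥) : coad ξ x = 0 := by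
  have hx : x 1 ^ 2 + x 2 ^ 2 = 0 := not_not.1 hx
  have h1 : x 1 = 0 := by nlinarith [sq_nonneg (x 1), sq_nonneg (x 2)]
  have h2 : x 2 = 0 := by nlinarith [sq_nonneg (x 1), sq_nonneg (x 2)]
  rw [coad_apply, sharp_eq, h1, h2]
  ext i
  fin_cases i <;> simp [pt]

theorem coAd_apply_of_notMem {x : Dual} (hx : x ∉ Ω) (ξ : 𝔥) : coAd ξ x = x := by
  have hsum := (NormedSpace.exp_series_hasSum_exp' (𝕂 := ℝ) (coad ξ)).mapL
    (ContinuousLinearMap.apply ℝ Dual x)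
  have hterm : ∀ n ≠ 0,
      ContinuousLinearMap.apply ℝ Dual x ((n.factorial : ℝ)⁻¹ • coad ξ ^ n) = 0 := fun n hn => by
    obtain ⟨m, rfl⟩ := Nat.exists_eq_succ_of_ne_zero hn
    simp [pow_succ, coad_apply_of_notMem hx]
  simpa [coAd] using hsum.unique (hasSum_single 0 hterm)

theorem coAd_neg_apply (ξ : 𝔥) (x : Dual) : coAd (-ξ) (coAd ξ x) = x := by
  have h : coAd (-ξ) * coAd ξ = 1 := by
    let := NormedAlgebra.restrictScalars ℚ ℝ (Dual →L[ℝ] Dual)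
    rw [coAd, coAd, coad_neg, ← NormedSpace.exp_add_of_commute (Commute.neg_left (Commute.refl _)),
      neg_add_cancel, NormedSpace.exp_zero]
  exact congrArg (fun L => L x) h

theorem coAd_mem_Ω {x : Dual} (hx : x ∈ Ω) (ξ : 𝔥) : coAd ξ x ∈ Ω := by
  by_contra h
  have hfix := coAd_apply_of_notMem h (-ξ)
  rw [coAd_neg_apply] at hfix
  exact h (hfix ▸ hx)

theorem coadjointOrbit_subset {x : Dual} (hx : x ∈ Ω) : coadjointOrbit x ⊆ Ω := by
  rintro _ ⟨l, rfl⟩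
  induction l with
  | nil => exact hx
  | cons ξ l ih =>
    rw [List.map_cons, List.prod_cons]
    exact coAd_mem_Ω ih ξ

theorem orbitDim_eq_finrank_range (x : Dual) :
    orbitDim x = Module.finrank ℝ (LinearMap.range (sharp x : 𝔥 →ₗ[ℝ] Dual)) := by
  have hrange : (Set.range fun ξ : 𝔥 => coad ξ x) =
      LinearMap.range (sharp x : 𝔥 →ₗ[ℝ] Dual) := by
    rw [LinearMap.coe_range, ← (Equiv.neg 𝔥).surjective.range_comp]
    exact congrArg Set.range (funext fun ξ => by simp [coad_apply])
  rw [orbitDim, hrange, Submodule.span_eq]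

theorem mem_Ω_of_orbitDim {x : Dual} (h : orbitDim x ≠ 0) : x ∈ Ω := by
  by_contra hx
  have hzero : (fun ξ => coad ξ x) = fun _ => 0 := funext (coad_apply_of_notMem hx)
  exact h (by
    rw [orbitDim, hzero, Set.range_const, Submodule.span_zero_singleton, finrank_bot])

theorem beta_ne_zero {x : Dual} (hx : x ∈ Ω) : beta x ≠ 0 := fun h => hx <| by
  rw [← beta_apply_one x, ← beta_apply_two x, h, 𝔥.zero_apply, 𝔥.zero_apply]
  norm_num

theorem orbitDim_of_mem_Ω {x : Dual} (hx : x ∈ Ω) : orbitDim x = 2 := by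
  have hrank := (sharp x : 𝔥 →ₗ[ℝ] Dual).finrank_range_add_finrank_ker
  rw [ker_sharp hx, finrank_span_singleton (beta_ne_zero hx), finrank_𝔥] at hrank
  rw [orbitDim_eq_finrank_range]
  omega

theorem Ω_eq_orbits : Ω = {y | ∃ x : Dual, orbitDim x = 2 ∧ y ∈ coadjointOrbit x} := by
  ext y
  constructor
  · exact fun hy => ⟨y, orbitDim_of_mem_Ω hy, [], rfl⟩
  · rintro ⟨x, hx, hy⟩
    exact coadjointOrbit_subset (mem_Ω_of_orbitDim (hx ▸ two_ne_zero)) hy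

/-! ### The equation `H_{x₁} g = a` -/

section CohomologicalEquation

open Filter Topology

theorem smul_pt (c p y z : ℝ) : c • pt p y z = pt (c * p) (c * y) (c * z) := by
  ext i
  fin_cases i <;> rfl

theorem abs_lt_sqrt_sq_add_sq {u : ℝ} (hu : 0 < u) (v : ℝ) : |v| < √(u ^ 2 + v ^ 2) := by
  rw [← Real.sqrt_sq_eq_abs]
  exact Real.sqrt_lt_sqrt (sq_nonneg v) (by nlinarith)

theorem add_sqrt_pos {u : ℝ} (hu : 0 < u) (v : ℝ) : 0 < v + √(u ^ 2 + v ^ 2) := by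
  linarith [(abs_lt.1 (abs_lt_sqrt_sq_add_sq hu v)).1]

theorem neg_add_sqrt_pos {u : ℝ} (hu : 0 < u) (v : ℝ) : 0 < -v + √(u ^ 2 + v ^ 2) := by
  linarith [(abs_lt.1 (abs_lt_sqrt_sq_add_sq hu v)).2]

theorem phi_eq {u : ℝ} (hu : 0 < u) (v : ℝ) :
    phi u v = (√(v + √(u ^ 2 + v ^ 2)), √(-v + √(u ^ 2 + v ^ 2))) := by
  have hp := add_sqrt_pos hu v
  have hm := neg_add_sqrt_pos hu v
  have hmul : √(v + √(u ^ 2 + v ^ 2)) * √(-v + √(u ^ 2 + v ^ 2)) = u := by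
    rw [← Real.sqrt_mul hp.le, Real.sqrt_eq_iff_mul_self_eq_of_pos hu]
    linear_combination -Real.sq_sqrt (by positivity : 0 ≤ u ^ 2 + v ^ 2)
  rw [phi]
  split_ifs with h1 h2
  · rw [eq_div_of_mul_eq (Real.sqrt_pos.2 hp).ne' ((mul_comm _ _).trans hmul)]
  · rw [eq_div_of_mul_eq (Real.sqrt_pos.2 hm).ne' hmul]
  · obtain rfl : v = 0 := le_antisymm (not_lt.1 h1) (not_lt.1 h2)
    simp [Real.sqrt_sq hu.le]

/-- The point `(0, φ(u, t))`, in a form that is continuous up to `u = 0`. -/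
noncomputable def phiPt (u t : ℝ) : Dual :=
  pt 0 (√(t + √(u ^ 2 + t ^ 2))) (√(-t + √(u ^ 2 + t ^ 2)))

theorem phiPt_mem_Ω {u : ℝ} (hu : 0 < u) (t : ℝ) : phiPt u t ∈ Ω := by
  have hp := Real.sqrt_pos.2 (add_sqrt_pos hu t)
  exact pt_mem_Ω.2 (by positivity)

theorem continuous_phiPt : Continuous fun q : ℝ × ℝ => phiPt q.1 q.2 := by
  refine continuous_pi fun i => ?_
  fin_cases i <;> simp only [phiPt, pt] <;> fun_prop

theorem hasDerivAt_phiPt {u : ℝ} (hu : 0 < u) (t : ℝ) :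
    HasDerivAt (phiPt u) ((2 * √(u ^ 2 + t ^ 2))⁻¹ • sharp (phiPt u t) (X 0)) t := by
  have hp := add_sqrt_pos hu t
  have hm := neg_add_sqrt_pos hu t
  have hR : 0 < √(u ^ 2 + t ^ 2) := Real.sqrt_pos.2 (by positivity)
  have hsqrt : HasDerivAt (fun t => √(u ^ 2 + t ^ 2)) (t / √(u ^ 2 + t ^ 2)) t := by
    convert ((hasDerivAt_pow 2 t).const_add (u ^ 2)).sqrt (by positivity) using 1
    push_cast
    field_simp
  have hp' := ((hasDerivAt_id t).add hsqrt).sqrt hp.ne'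
  have hm' := ((hasDerivAt_id t).neg.add hsqrt).sqrt hm.ne'
  refine (hasDerivAt_pt (hasDerivAt_const t 0) hp' hm').congr_deriv ?_
  have hp0 := Real.sqrt_pos.2 hp
  have hm0 := Real.sqrt_pos.2 hm
  rw [sharp_X_zero, smul_pt, mul_zero]
  congr 1
  · change (1 + t / √(u ^ 2 + t ^ 2)) / (2 * √(t + √(u ^ 2 + t ^ 2))) =
      (2 * √(u ^ 2 + t ^ 2))⁻¹ * √(t + √(u ^ 2 + t ^ 2))
    field_simp
    rw [Real.sq_sqrt hp.le, add_comm]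
  · change (-1 + t / √(u ^ 2 + t ^ 2)) / (2 * √(-t + √(u ^ 2 + t ^ 2))) =
      (2 * √(u ^ 2 + t ^ 2))⁻¹ * -√(-t + √(u ^ 2 + t ^ 2))
    field_simp
    rw [Real.sq_sqrt hm.le]
    ring

theorem integral_phi_eq_sub {a g : Ω → ℝ} (ha : Smooth a) (hg : Smooth g)
    (h : ∀ x : Ω, D g x (sharp x (X 0)) = a x) {u : ℝ} (hu : 0 < u) (s t : ℝ) :
    (∫ r in s..t, ext0 a ![0, (phi u r).1, (phi u r).2] / (2 * √(u ^ 2 + r ^ 2))) =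
      ext0 g (phiPt u t) - ext0 g (phiPt u s) := by
  let c : ℝ → Ω := fun r => ⟨phiPt u r, phiPt_mem_Ω hu r⟩
  have hc : Continuous c :=
    (continuous_phiPt.comp (Continuous.prodMk_right u)).subtype_mk _
  have hint : ∀ r, ext0 a ![0, (phi u r).1, (phi u r).2] / (2 * √(u ^ 2 + r ^ 2)) =
      a (c r) / (2 * √(u ^ 2 + r ^ 2)) := fun r => by
    rw [phi_eq hu, ← ext0_coe a]
    rfl
  simp only [hint]
  rw [ext0_coe g (c t), ext0_coe g (c s)]
  refine intervalIntegral.integral_eq_sub_of_hasDerivAt (f := fun r => g (c r)) (fun r _ => ?_)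
    (((ha.continuous.comp hc).div (by fun_prop) fun r => by positivity).intervalIntegrable _ _)
  refine (hasDerivAt_smooth_comp hg (c := c) (hasDerivAt_phiPt hu r)).congr_deriv ?_
  rw [map_smul, smul_eq_mul, h (c r), div_eq_inv_mul]

theorem exists_tendsto_integral {a g : Ω → ℝ} (ha : Smooth a) (hg : Smooth g)
    (h : ∀ x : Ω, D g x (sharp x (X 0)) = a x) :
    ∃ L : ℝ, Tendsto
      (fun u : ℝ => ∫ t in (-1 : ℝ)..1,
        ext0 a ![0, (phi u t).1, (phi u t).2] / (2 * √(u ^ 2 + t ^ 2))) (𝓝[>] 0) (𝓝 L) := by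
  have hlim : ∀ t, phiPt 0 t ∈ Ω →
      Tendsto (fun u => ext0 g (phiPt u t)) (𝓝[>] 0) (𝓝 (ext0 g (phiPt 0 t))) := fun t ht =>
    ((hg.diffAt ⟨_, ht⟩).continuousAt.tendsto.comp
      ((continuous_phiPt.comp (Continuous.prodMk_left t)).tendsto 0)).mono_left nhdsWithin_le_nhds
  refine ⟨_, ((hlim 1 (pt_mem_Ω.2 (by norm_num))).sub
    (hlim (-1) (pt_mem_Ω.2 (by norm_num)))).congr' ?_⟩
  filter_upwards [self_mem_nhdsWithin] with u hu using (integral_phi_eq_sub ha hg h hu _ _).symm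

end CohomologicalEquation

end LiePoissonH

open LiePoissonH in
theorem mainTheorem11 :
    -- `Ω` is the union of the two-dimensional coadjoint orbits
    (Ω = {y | ∃ x : Dual, orbitDim x = 2 ∧ y ∈ coadjointOrbit x}) ∧
    -- tangential Poisson cohomology
    Nonempty (Htan 0 ≃ₗ[Cas] Cas) ∧
    IsInfDim (Htan 1) ∧
    (∀ k, 1 < k → Subsingleton (Htan k)) ∧
    -- Poisson cohomology
    Nonempty (H 0 ≃ₗ[Cas] Cas) ∧
    (∃ e : H 1 ≃ₗ[Cas] Htan 1 × Submodule.span Cas {transv},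
      (∀ A : cocyclesTan 1, e (H.mk (tanIncl 1 A)) = (Htan.mk A, 0)) ∧
      ∀ (Q : cocycles 1) (x : Ω) (ξ : 𝔥),
        (e (H.mk Q)).2.1.val x ![ξ] = Q.1.val x ![beta x] * transv.val x ![ξ]) ∧
    Nonempty (H 2 ≃ₗ[Cas] Htan 1) ∧
    IsInfDim (H 1) ∧
    IsInfDim (H 2) ∧
    (∀ k, 2 < k → Subsingleton (H k)) ∧
    -- the necessary condition for `H_{x₁} g = a`
    (∀ a g : Ω → ℝ, Smooth a → Smooth g →
      (∀ x y : Ω, x.1 1 = y.1 1 → x.1 2 = y.1 2 → a x = a y ∧ g x = g y) →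
      (∀ x : Ω, D g x (sharp x (X 0)) = a x) →
      ∃ L : ℝ, Filter.Tendsto
        (fun u : ℝ => ∫ t in (-1 : ℝ)..1,
          ext0 a ![0, (phi u t).1, (phi u t).2] / (2 * √(u ^ 2 + t ^ 2)))
        (nhdsWithin 0 (Set.Ioi 0)) (nhds L)) := by
  obtain ⟨e, hincl, htransv⟩ := exists_H_one_equiv
  exact ⟨Ω_eq_orbits, ⟨HtanZeroEquiv⟩,
    isInfDim_of_surjective_Htan_one (p := LinearMap.id) Function.surjective_id,
    fun _ hk => subsingleton_Htan hk, ⟨HZeroEquiv⟩,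
    ⟨e, hincl, fun Q _ _ => by rw [htransv, transvPart_mk]⟩, ⟨contrHEquiv 0⟩,
    isInfDim_of_surjective_Htan_one (p := LinearMap.fst Cas _ _ ∘ₗ e.toLinearMap)
      (Prod.fst_surjective.comp e.surjective),
    isInfDim_of_surjective_Htan_one (contrHEquiv 0).surjective,
    fun _ hk => subsingleton_H hk, fun _ _ ha hg _ h => exists_tendsto_integral ha hg h⟩
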